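/- **Conventions.** All of $\lambda,\kappa,\partial,\theta,\mu,\chi$ are infinite cardinals. For a set $x$, $\mathrm{trcl}(x)$ is the least transitive set having $x$ as a member, and $\mathscr H(\chi)=\{x : |\mathrm{trcl}(x)|<\chi\}$. $[A]^{<\lambda}$ is the set of subsets of $A$ of cardinality $<\lambda$; $[\mathscr U]^{\ell}$ and $[\mathscr U]^{\le 2}$ are the sets of subsets of $\mathscr U$ with exactly $\ell$, respectively at most $2$, elements. If $<_*$ is a well-ordering of $\mathscr H(\chi)$ and $\mathscr B$ is an expansion of $(\mathscr H(\chi),\in,<_*)$, then $\mathrm{Sk}(u,\mathscr B)$ is the Skolem hull of $u\subseteq\mathscr H(\chi)$, i.e. the closure of $u$ under the functions sending $\bar a$ to the $<_*$-least $y$ with $\mathscr B\models\varphi(y,\bar a)$ (when there is one), for $\varphi$ a first-order formula in the vocabulary of $\mathscr B$. **The relation** $\theta\to_{\mathrm{sq}}(\partial)^{\lambda,2}_{\kappa}$ means: $\theta>\partial\ge\kappa\ge\lambda$, and whenever $\chi>\theta$ is a cardinal with $\mathrm{cf}(\chi)\ge\lambda$, $<_*$ is a well-ordering of $\mathscr H(\chi)$,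 and $\mathscr B$ is an expansion of $(\mathscr H(\chi),\in,<_*)$ with vocabulary of cardinality $\le\lambda$, there are $\mathscr U$, $\langle N_u:u\in[\mathscr U]^{\le2}\rangle$ and $\langle\pi_{u,v}:u,v\in[\mathscr U]^{\le2},|u|=|v|\rangle$ such that for all $u,v\in[\mathscr U]^{\le2}$: 1. $\mathscr U\subseteq\theta$ has order type $\partial$; 2. $N_u\prec\mathscr B$ and $[N_u]^{<\lambda}\subseteq N_u$; 3. $N_u\cap\mathscr U=u$; 4. $|N_u|=\kappa$ and $\kappa+1\subseteq N_u$; 5. $N_u\cap N_v\prec N_{u\cap v}$; 6. if $|u|=|v|$ then $\pi_{u,v}$ is an isomorphism from $N_v$ onto $N_u$ mapping $v$ onto $u$; 7. if $u_1\subseteq u_2$ and $v_1\subseteq v_2$ are in $[\mathscr U]^{\le2}$, $|u_2|=|v_2|$ and $\pi_{u_2,v_2}[v_1]=u_1$, then $\pi_{u_1,v_1}$ and $\pi_{u_2,v_2}$ agree on $N_{v_1}\cap N_{v_2}$; 8. for each $\ell\in\{1,2\}$ the sets $N_u\cap\partial$, $u\in[\mathscr U]^{\ell}$, are pairwise equal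 and included in $N_\emptyset$. **Fact.** Assume $\lambda=\lambda^{<\lambda}<\partial<\theta<\mu=\mu^{\theta}$, $|\alpha|^{\lambda}<\mu$ for every ordinal $\alpha<\mu$, $\theta>\beth_2(\kappa)=2^{2^{\kappa}}$, $\partial=\kappa^{+}$ and $\kappa=\kappa^{\lambda}$. Then: (a) $\lambda=\lambda^{<\lambda}<\partial<\theta<\mu=\mu^{\theta}$; (b) $\theta\to_{\mathrm{sq}}(\partial)^{\lambda,2}_{\lambda}$; (c) for every cardinal $\chi>\theta$ with $\mathrm{cf}(\chi)\ge\lambda$ (for instance $\chi=\beth_2(\mu)^{+}$) and every well-ordering $<_*$ of $\mathscr H(\chi)$ there is an expansion $\mathscr B$ of $(\mathscr H(\chi),\in,<_*)$ with vocabulary of cardinality $\lambda$ such that for every finite $u\subseteq\mathscr H(\chi)$ the Skolem hull $N=\mathrm{Sk}(u,\mathscr B)$ has cardinality $\lambda$ and satisfies $[N]^{<\lambda}\subseteq N$. -/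

import Mathlib

open Cardinal FirstOrder

universe u

namespace SqPartition

/-- The transitive closure of `x`: the least transitive family of sets having `x` as a member. -/
def trcl (x : ZFSet.{u}) : Set ZFSet.{u} :=
  {y | ∀ Y : ZFSet.{u}, x ∈ Y → Y.IsTransitive → y ∈ Y}

/-- `H(χ)`: the sets whose transitive closure has cardinality `< χ`. -/
def HSet (χ : Cardinal.{u}) : Set ZFSet.{u} :=
  {x | #(trcl x) < Cardinal.lift.{u + 1} χ}

/-- An expansion of the structure `(H(χ), ∈, r)`: a first-order structure with universe `H(χ)`
whose vocabulary has a symbol interpreted as membership and a symbol interpreted as `r`. -/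
structure Expansion (χ : Cardinal.{u}) (r : HSet χ → HSet χ → Prop) where
  /-- the vocabulary -/
  lang : FirstOrder.Language.{u, u}
  /-- the interpretation of the vocabulary on `H(χ)` -/
  str : lang.Structure (HSet χ)
  memSym : lang.Relations 2
  ltSym : lang.Relations 2
  memSym_iff : ∀ a b : HSet χ, str.RelMap memSym ![a, b] ↔ a.1 ∈ b.1
  ltSym_iff : ∀ a b : HSet χ, str.RelMap ltSym ![a, b] ↔ r a b

instance instStructure {χ : Cardinal.{u}} {r : HSet χ → HSet χ → Prop} (B : Expansion χ r) :
    B.lang.Structure (HSet χ) := B.str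

/-- The Skolem hull in `B` of a subset `A` of `H(χ)`, for the Skolem functions given by the
well-ordering `r`: the least set containing `A` which contains the `r`-least element `y` satisfying
`φ(y, a)` whenever `φ` is a first-order formula, the parameters `a` are in the hull, and some
element satisfies `φ(·, a)`. -/
inductive SkolemHull {χ : Cardinal.{u}} {r : HSet χ → HSet χ → Prop} (B : Expansion χ r)
    (A : Set (HSet χ)) : HSet χ → Prop
  | base (x : HSet χ) (hx : x ∈ A) : SkolemHull B A x
  | skolem (n : ℕ) (φ : B.lang.Formula (Fin (n + 1))) (a : Fin n → HSet χ)
      (ha : ∀ i, SkolemHull B A (a i)) (y : HSet χ)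
      (hy : φ.Realize (Fin.cons y a : Fin (n + 1) → HSet χ))
      (hmin : ∀ z : HSet χ, φ.Realize (Fin.cons z a : Fin (n + 1) → HSet χ) → ¬ r z y) :
      SkolemHull B A y

/-- A subset of `H(χ)` viewed as a family of sets. -/
def toSets {χ : Cardinal.{u}} (A : Set (HSet χ)) : Set ZFSet.{u} := Subtype.val '' A

/-- `[A]^{<lam} ⊆ A`: every subset of `A` of cardinality `< lam` is a member of `A`. -/
def SubsetClosed (lam : Cardinal.{u}) (A : Set ZFSet.{u}) : Prop :=
  ∀ x : ZFSet.{u}, (∀ z ∈ x, z ∈ A) → x.card < lam → x ∈ A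

/-- A family of ordinals, as a family of (von Neumann ordinal) sets. -/
def ordSets (s : Set Ordinal.{u}) : Set ZFSet.{u} := Ordinal.toZFSet '' s

/-- `[U]^{≤2}`: the subsets of `U` with at most two elements. -/
def AtMostTwo (U : Set Ordinal.{u}) : Set (Finset Ordinal.{u}) :=
  {w | (↑w : Set Ordinal.{u}) ⊆ U ∧ w.card ≤ 2}

open Classical in
/-- A solution `(U, ⟨N_w⟩, ⟨π_{w,v}⟩)`, `w, v ∈ [U]^{≤2}`, for the parameters
`(θ, del, κ, lam, B)`; `del` is the order type of `U`. The values of `N` outside `[U]^{≤2}` are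
irrelevant. -/
structure Solution (θ del κ lam : Cardinal.{u}) {χ : Cardinal.{u}}
    {r : HSet χ → HSet χ → Prop} (B : Expansion χ r) where
  U : Set Ordinal.{u}
  N : Finset Ordinal.{u} → B.lang.ElementarySubstructure (HSet χ)
  /-- `π w v` is an isomorphism from `N v` onto `N w`. -/
  π : ∀ w v : Finset Ordinal.{u}, w ∈ AtMostTwo U → v ∈ AtMostTwo U → w.card = v.card →
    (N v ≃[B.lang] N w)
  U_lt : ∀ α ∈ U, α < θ.ord
  otp_U : Ordinal.type (fun a b : U => a < b) = Ordinal.lift.{u + 1} del.ord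
  closed : ∀ w ∈ AtMostTwo U, SubsetClosed lam (toSets (N w : Set (HSet χ)))
  inter_U : ∀ w ∈ AtMostTwo U,
    toSets (N w : Set (HSet χ)) ∩ ordSets U = ordSets (↑w : Set Ordinal.{u})
  card_N : ∀ w ∈ AtMostTwo U, #(N w) = Cardinal.lift.{u + 1} κ
  succ_subset : ∀ w ∈ AtMostTwo U,
    ordSets (Set.Iio (Order.succ κ.ord)) ⊆ toSets (N w : Set (HSet χ))
  /-- `N w ∩ N v ≺ N (w ∩ v)` -/
  inter_elem : ∀ w ∈ AtMostTwo U, ∀ v ∈ AtMostTwo U,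
    ∃ S : B.lang.ElementarySubstructure (N (w ∩ v)),
      Subtype.val '' (S : Set (N (w ∩ v))) = (N w : Set (HSet χ)) ∩ (N v : Set (HSet χ))
  /-- `π w v` maps `v` onto `w`. -/
  π_image : ∀ w v (hw : w ∈ AtMostTwo U) (hv : v ∈ AtMostTwo U) (h : w.card = v.card),
    {y : ZFSet.{u} | ∃ x : N v, x.1.1 ∈ ordSets (↑v : Set Ordinal.{u}) ∧
      (π w v hw hv h x).1.1 = y} = ordSets (↑w : Set Ordinal.{u})
  /-- If `w₁ ⊆ w₂`, `v₁ ⊆ v₂` and `π w₂ v₂` maps `v₁` onto `w₁`, then `π w₁ v₁` and `π w₂ v₂` agree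
  on their common domain. -/
  π_compat : ∀ w₁ v₁ w₂ v₂ (hw₁ : w₁ ∈ AtMostTwo U) (hv₁ : v₁ ∈ AtMostTwo U)
    (hw₂ : w₂ ∈ AtMostTwo U) (hv₂ : v₂ ∈ AtMostTwo U)
    (h₁ : w₁.card = v₁.card) (h₂ : w₂.card = v₂.card),
    w₁ ⊆ w₂ → v₁ ⊆ v₂ →
    {y : ZFSet.{u} | ∃ x : N v₂, x.1.1 ∈ ordSets (↑v₁ : Set Ordinal.{u}) ∧
      (π w₂ v₂ hw₂ hv₂ h₂ x).1.1 = y} = ordSets (↑w₁ : Set Ordinal.{u}) →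
    ∀ (x : HSet χ) (hx₁ : x ∈ N v₁) (hx₂ : x ∈ N v₂),
      (π w₁ v₁ hw₁ hv₁ h₁ ⟨x, hx₁⟩).1 = (π w₂ v₂ hw₂ hv₂ h₂ ⟨x, hx₂⟩).1
  /-- For `ℓ = 1, 2` the sets `N w ∩ del`, `w ∈ [U]^ℓ`, are pairwise equal. -/
  inter_del_eq : ∀ w ∈ AtMostTwo U, ∀ v ∈ AtMostTwo U, w.card = v.card → 1 ≤ w.card →
    toSets (N w : Set (HSet χ)) ∩ ordSets (Set.Iio del.ord) =
      toSets (N v : Set (HSet χ)) ∩ ordSets (Set.Iio del.ord)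
  /-- They are included in `N ∅`. -/
  inter_del_subset : ∀ w ∈ AtMostTwo U, 1 ≤ w.card →
    toSets (N w : Set (HSet χ)) ∩ ordSets (Set.Iio del.ord) ⊆ toSets (N ∅ : Set (HSet χ))

/-- The relation `θ →_sq (del)_κ^{lam, 2}` for infinite cardinals. The cardinals `χ > θ` considered
have cofinality at least `lam` (e.g. they may be regular), so that `H(χ)` contains all its subsets
of cardinality `< lam`. -/
def SqArrow (θ del κ lam : Cardinal.{u}) : Prop :=
  del < θ ∧ κ ≤ del ∧ lam ≤ κ ∧
    ∀ χ : Cardinal.{u}, θ < χ → lam ≤ χ.ord.cof →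
      ∀ r : HSet χ → HSet χ → Prop, IsWellOrder (HSet χ) r →
        ∀ B : Expansion χ r, B.lang.card ≤ lam → Nonempty (Solution θ del κ lam B)

/-- The requirement on the structure `B` expanding `(H(χ), ∈, r)`: the vocabulary has cardinality
`lam`, and the Skolem hull of every finite set has cardinality `lam` and is closed under subsets of
cardinality `< lam`. -/
def GoodExpansion (lam : Cardinal.{u}) {χ : Cardinal.{u}} {r : HSet χ → HSet χ → Prop}
    (B : Expansion χ r) : Prop :=
  B.lang.card = lam ∧
    ∀ A : Set (HSet χ), A.Finite →
      #{x // SkolemHull B A x} = Cardinal.lift.{u + 1} lam ∧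
      SubsetClosed lam (toSets {x | SkolemHull B A x})

/-- The demands on the cardinals `μ, θ, del, lam` under which the forcing is constructed. -/
structure ForcingHypothesis (μ θ del lam : Cardinal.{u}) : Prop where
  powerlt_eq : lam ^< lam = lam
  lam_lt : lam < del
  del_lt : del < θ
  θ_lt : θ < μ
  power_eq : μ ^ θ = μ
  sq : SqArrow θ del lam lam
  exists_expansion : ∀ χ : Cardinal.{u}, θ < χ → lam ≤ χ.ord.cof →
    ∀ r : HSet χ → HSet χ → Prop, IsWellOrder (HSet χ) r →
      ∃ B : Expansion χ r, GoodExpansion lam B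

end SqPartition

/-! Operations on $\mathscr H(\chi)$ are coded by well-founded terms built from variables, constants
for the ordinals $\le\lambda$, first-order definitions, least witnesses, composition, and the
gathering of fewer than $\lambda$ values into a set. Since $\lambda^{<\lambda}=\lambda$ there are at
most $\lambda$ codes (`mk_code_le`), and $\mathrm{cf}(\chi)\ge\lambda$ keeps the gathered sets in
$\mathscr H(\chi)$. The values of all codes at one assignment therefore form a Skolem-closed set of
size $\lambda$ containing all its subsets of size $<\lambda$. Clause (c) follows by making every
code a function symbol: Skolem hulls of finite sets are then exactly such sets of values
(`skolemHull_codeExpansion`).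

For (b), call the set of equations between codes true at a tuple of ordinals its type. There are at
most $2^\lambda\le\kappa^\lambda=\kappa$ types. As $\theta>2^{2^\kappa}$, two rounds of
end-homogeneity (`exists_endHomogeneous`) and a pigeonhole give a sequence of length $\kappa^+$,
preceded by one extra point $\bot$, on which types of triples and of suitable quadruples are
constant (`exists_homogeneous`). Let $\mathscr U$ be the sequence without $\bot$. $N_{\{i,j\}}$
consists of all code values at the pair, $N_{\{i\}}$ of the values at triples $h<i<j$ of codes
depending only on $i$, and $N_\emptyset$ of the values of codes constant on triples. The
isomorphisms send the value of a code to the value of the same code at the other set.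

The crux is $N_u\cap N_v\subseteq N_{u\cap v}$ (`modelSet_inter`). A common element is an equation
between two codes; homogeneity allows the points outside $u\cap v$ to be moved, so the value does
not depend on them. Elementarity follows because the intersection is Skolem closed. For ordinals
below $\partial=\kappa^+$ a second colouring records the values themselves. It has up to $2^\kappa$
colours, too many for the pigeonhole on $\kappa^+$ indices, so the colour of a triple still depends
on its first point; taking $\bot$ as first point removes this dependence. -/

namespace SqPartition

/-! ### Membership in `H(χ)` -/

section HSet

variable {χ : Cardinal.{u}}

/-- The transitive closure as a set. -/
noncomputable def trclSet (x : ZFSet.{u}) : ZFSet.{u} :=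
  ZFSet.sep (· ∈ trcl x) (ZFSet.vonNeumann (Order.succ x.rank))

/-- The stage of the cumulative hierarchy just above `x` is transitive and contains `x`, so
separating inside it loses nothing. Cardinalities can then be computed in the universe of $\chi$. -/
theorem mem_trclSet {x y : ZFSet.{u}} : y ∈ trclSet x ↔ y ∈ trcl x := by
  rw [trclSet, ZFSet.mem_sep, and_iff_right_iff_imp]
  exact fun h => h _ (ZFSet.mem_vonNeumann_succ x) (ZFSet.isTransitive_vonNeumann _)

theorem self_mem_trclSet (x : ZFSet.{u}) : x ∈ trclSet x :=
  mem_trclSet.2 fun _ h _ => h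

theorem isTransitive_trclSet (x : ZFSet.{u}) : (trclSet x).IsTransitive := by
  intro y hy z hz
  rw [mem_trclSet] at hy ⊢
  exact fun Y hxY hY => hY y (hy Y hxY hY) hz

theorem mem_HSet_iff {x : ZFSet.{u}} : x ∈ HSet χ ↔ (trclSet x).card < χ := by
  have : ((trclSet x : ZFSet.{u}) : Set ZFSet.{u}) = trcl x := by
    ext y
    exact mem_trclSet
  rw [HSet, Set.mem_ofPred_eq, ← this, ← Cardinal.lift_lt.{u, u + 1}, ← ZFSet.cardinalMk_coe_sort]
  rfl

theorem mem_HSet_of_isTransitive {x Y : ZFSet.{u}} (hx : x ∈ Y) (hY : Y.IsTransitive)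
    (h : Y.card < χ) : x ∈ HSet χ :=
  mem_HSet_iff.2 ((ZFSet.card_mono fun _ hy => mem_trclSet.1 hy Y hx hY).trans_lt h)

theorem toZFSet_mem_HSet (hχ : ℵ₀ ≤ χ) {α : Ordinal.{u}} (hα : α < χ.ord) :
    α.toZFSet ∈ HSet χ := by
  refine mem_HSet_of_isTransitive (Y := (Order.succ α).toZFSet)
    (Ordinal.toZFSet_mem_toZFSet_iff.2 (Order.lt_succ α))
    (ZFSet.isOrdinal_toZFSet _).isTransitive ?_
  rw [Ordinal.card_toZFSet, ← Cardinal.lt_ord]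
  exact (Cardinal.isSuccLimit_ord hχ).succ_lt hα

/-- The range together with the union of the transitive closures of its members is transitive. The
cofinality bounds the sizes of these closures by one cardinal below $\chi$, which keeps the union
small. -/
theorem range_mem_HSet (hχ : ℵ₀ ≤ χ) {ι : Type u} (hι : #ι < χ.ord.cof) (f : ι → ZFSet.{u})
    (hf : ∀ i, f i ∈ HSet χ) : ZFSet.range f ∈ HSet χ := by
  refine mem_HSet_of_isTransitive
    (Y := insert (ZFSet.range f) (ZFSet.iUnion fun i => trclSet (f i))) (ZFSet.mem_insert _ _) ?_ ?_
  · intro y hy z hz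
    rw [ZFSet.mem_insert_iff] at hy ⊢
    right
    rcases hy with rfl | hy
    · obtain ⟨i, rfl⟩ := ZFSet.mem_range.1 hz
      exact ZFSet.mem_iUnion.2 ⟨i, self_mem_trclSet _⟩
    · obtain ⟨i, hi⟩ := ZFSet.mem_iUnion.1 hy
      exact ZFSet.mem_iUnion.2 ⟨i, isTransitive_trclSet _ _ hi hz⟩
  · have hιχ : #ι < χ := hι.trans_le ((Ordinal.cof_le_card _).trans_eq (Cardinal.card_ord χ))
    refine ZFSet.card_insert_le.trans_lt (Cardinal.add_lt_of_lt hχ ?_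
      (Cardinal.one_lt_aleph0.trans_le hχ))
    have h1 : (ZFSet.iUnion fun i => trclSet (f i)).card ≤ Cardinal.sum fun i => (trclSet (f i)).card := by
      simpa using ZFSet.lift_card_iUnion_le_sum_card (f := fun i => trclSet (f i))
    refine h1.trans_lt ((Cardinal.sum_le_mk_mul_iSup _).trans_lt (Cardinal.mul_lt_of_lt hχ hιχ ?_))
    exact Cardinal.iSup_lt_of_lt_cof_ord hι fun i => mem_HSet_iff.1 (hf i)

end HSet

/-! ### Codes for definable functions

`Code L K` is a type of codes for functions `(ℕ → H) → H` on an `L`-structure `H`: the codes are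
closed under definability, definition of least witnesses, and formation of short families. -/

section Code

/-- The constructors of codes. -/
inductive Shape (L : FirstOrder.Language.{u, u}) (K : Type u) : Type u
  | var (n : ℕ)
  | const (k : K)
  | shift
  | eq
  | fn (n : ℕ) (f : L.Functions n)
  | rel (n : ℕ) (R : L.Relations n)
  | bot
  | imp
  | all
  | least
  | collect (k : K)
  | app (n : ℕ)

variable {L : FirstOrder.Language.{u, u}} {K : Type u} [LinearOrder K]

/-- The number of arguments of a constructor. -/
def Shape.Arity : Shape L K → Type u
  | var _ => PEmpty
  | const _ => PEmpty
  | shift => PUnit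
  | eq => ULift (Fin 2)
  | fn n _ => ULift (Fin n)
  | rel n _ => ULift (Fin n)
  | bot => PEmpty
  | imp => ULift (Fin 2)
  | all => PUnit
  | least => PUnit
  | collect k => Set.Iio k
  | app n => ULift (Fin (n + 1))

variable (L K) in
/-- Codes for functions of infinitely many variables. -/
abbrev Code : Type u := WType (Shape.Arity : Shape L K → Type u)

variable {H : Type*}

/-- A finite tuple, continued by a fixed value. -/
def pad (d : H) {n : ℕ} (a : Fin n → H) (i : ℕ) : H := if h : i < n then a ⟨i, h⟩ else d

theorem pad_of_lt (d : H) {n : ℕ} (a : Fin n → H) (i : Fin n) : pad d a i = a i := by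
  simp [pad]

/-- Prepend a value to an assignment. -/
def prepend (z : H) (v : ℕ → H) : ℕ → H
  | 0 => z
  | n + 1 => v n

variable (K H) in
/-- The data needed to evaluate codes: a relation for choosing least witnesses, constants, two
distinct truth values, and an operation on short families. -/
structure Interp where
  r : H → H → Prop
  wo : IsWellOrder H r
  const : K → H
  tt : H
  ff : H
  tt_ne_ff : tt ≠ ff
  coll : ∀ k : K, (Set.Iio k → H) → H

namespace Interp

variable (I : Interp K H)

open Classical in
/-- The truth value of a proposition. -/
noncomputable def tv (p : Prop) : H := if p then I.tt else I.ff

theorem tv_eq_tt {p : Prop} : I.tv p = I.tt ↔ p := by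
  unfold tv
  split_ifs with h
  · simpa using h
  · simpa [h] using I.tt_ne_ff.symm

open Classical in
/-- The least element satisfying `p`, if there is one. -/
noncomputable def sk (p : H → Prop) : H :=
  if h : ∃ z, p z then I.wo.wf.min {z | p z} h else I.ff

theorem sk_spec {p : H → Prop} (h : ∃ z, p z) : p (I.sk p) := by
  rw [sk, dif_pos h]
  exact I.wo.wf.min_mem {z | p z} h

theorem sk_eq {p : H → Prop} {y : H} (hy : p y) (hmin : ∀ z, p z → ¬ I.r z y) : I.sk p = y := by
  have h : ∃ z, p z := ⟨y, hy⟩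
  have := I.wo
  refine (trichotomous_of I.r (I.sk p) y).resolve_left (hmin _ (I.sk_spec h)) |>.resolve_right ?_
  rw [sk, dif_pos h]
  exact I.wo.wf.not_lt_min {z | p z} hy

variable [L.Structure H]

/-- One step of the evaluation of a code. -/
noncomputable def step : (s : Shape L K) → (s.Arity → (ℕ → H) → H) → (ℕ → H) → H
  | .var n, _, v => v n
  | .const k, _, _ => I.const k
  | .shift, f, v => f ⟨⟩ fun n => v (n + 1)
  | .eq, f, v => I.tv (f ⟨0⟩ v = f ⟨1⟩ v)
  | .fn _ g, f, v => FirstOrder.Language.Structure.funMap g fun i => f ⟨i⟩ v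
  | .rel _ R, f, v => I.tv (FirstOrder.Language.Structure.RelMap R fun i => f ⟨i⟩ v)
  | .bot, _, _ => I.ff
  | .imp, f, v => I.tv (f ⟨0⟩ v = I.tt → f ⟨1⟩ v = I.tt)
  | .all, f, v => I.tv (∀ z, f ⟨⟩ (prepend z v) = I.tt)
  | .least, f, v => I.sk fun z => f ⟨⟩ (prepend z v) = I.tt
  | .collect k, f, v => I.coll k fun i => f i v
  | .app n, f, v => f ⟨0⟩ (pad I.ff fun i : Fin n => f ⟨i.succ⟩ v)

/-- The value of a code. -/
noncomputable def eval : Code L K → (ℕ → H) → H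
  | ⟨s, f⟩ => I.step s fun i => eval (f i)

end Interp

open Interp

/-- The code of a variable. -/
def Code.var (n : ℕ) : Code L K := ⟨.var n, PEmpty.elim⟩
/-- The code of a constant. -/
def Code.const (k : K) : Code L K := ⟨.const k, PEmpty.elim⟩
/-- The code omitting the first variable. -/
def Code.shift (t : Code L K) : Code L K := ⟨.shift, fun _ => t⟩
/-- The code of an equality. -/
def Code.eq (s t : Code L K) : Code L K := ⟨.eq, fun i => ![s, t] i.down⟩
/-- The code of a function symbol. -/
def Code.fn {n : ℕ} (f : L.Functions n) (s : Fin n → Code L K) : Code L K :=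
  ⟨.fn n f, fun i => s i.down⟩
/-- The code of a relation symbol. -/
def Code.rel {n : ℕ} (R : L.Relations n) (s : Fin n → Code L K) : Code L K :=
  ⟨.rel n R, fun i => s i.down⟩
/-- The code of falsity. -/
def Code.bot : Code L K := ⟨.bot, PEmpty.elim⟩
/-- The code of an implication. -/
def Code.imp (s t : Code L K) : Code L K := ⟨.imp, fun i => ![s, t] i.down⟩
/-- The code of a universal quantification over the first variable. -/
def Code.all (t : Code L K) : Code L K := ⟨.all, fun _ => t⟩
/-- The code of the least witness for the first variable. -/
def Code.least (t : Code L K) : Code L K := ⟨.least, fun _ => t⟩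
/-- The code of a short family. -/
def Code.collect (k : K) (s : Set.Iio k → Code L K) : Code L K := ⟨.collect k, s⟩
/-- The code of a composition. -/
def Code.app (t : Code L K) {n : ℕ} (s : Fin n → Code L K) : Code L K :=
  ⟨.app n, fun i => (Fin.cons t s : Fin (n + 1) → Code L K) i.down⟩

variable [L.Structure H] (I : Interp K H) (v : ℕ → H)

@[simp] theorem eval_var (n : ℕ) : I.eval (Code.var n : Code L K) v = v n := rfl
@[simp] theorem eval_shift (t : Code L K) (z : H) :
    I.eval t.shift (prepend z v) = I.eval t v := rfl
@[simp] theorem eval_eq (s t : Code L K) :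
    I.eval (s.eq t) v = I.tv (I.eval s v = I.eval t v) := rfl
@[simp] theorem eval_fn {n : ℕ} (f : L.Functions n) (s : Fin n → Code L K) :
    I.eval (Code.fn f s) v = FirstOrder.Language.Structure.funMap f fun i => I.eval (s i) v := rfl
@[simp] theorem eval_rel {n : ℕ} (R : L.Relations n) (s : Fin n → Code L K) :
    I.eval (Code.rel R s) v = I.tv (FirstOrder.Language.Structure.RelMap R fun i => I.eval (s i) v) := rfl
@[simp] theorem eval_bot : I.eval (Code.bot : Code L K) v = I.ff := rfl
@[simp] theorem eval_imp (s t : Code L K) :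
    I.eval (s.imp t) v = I.tv (I.eval s v = I.tt → I.eval t v = I.tt) := rfl
@[simp] theorem eval_all (t : Code L K) :
    I.eval t.all v = I.tv (∀ z, I.eval t (prepend z v) = I.tt) := rfl
@[simp] theorem eval_least (t : Code L K) :
    I.eval t.least v = I.sk fun z => I.eval t (prepend z v) = I.tt := rfl
@[simp] theorem eval_collect (k : K) (s : Set.Iio k → Code L K) :
    I.eval (Code.collect k s) v = I.coll k fun i => I.eval (s i) v := rfl
@[simp] theorem eval_app (t : Code L K) {n : ℕ} (s : Fin n → Code L K) :
    I.eval (t.app s) v = I.eval t (pad I.ff fun i => I.eval (s i) v) := rfl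

end Code

open Interp

/-! ### Counting codes -/

section CodeCardinality

variable {L : FirstOrder.Language.{u, u}} {K : Type u} {lam : Cardinal.{u}}

/-- An injective description of the constructors of codes. -/
def Shape.toProd : Shape L K → Fin 12 × (ℕ ⊕ K ⊕ L.Symbols)
  | var n => (0, .inl n)
  | const k => (1, .inr (.inl k))
  | shift => (2, .inl 0)
  | eq => (3, .inl 0)
  | fn n f => (4, .inr (.inr (.inl ⟨n, f⟩)))
  | rel n R => (5, .inr (.inr (.inr ⟨n, R⟩)))
  | bot => (6, .inl 0)
  | imp => (7, .inl 0)
  | all => (8, .inl 0)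
  | least => (9, .inl 0)
  | collect k => (10, .inr (.inl k))
  | app n => (11, .inl n)

theorem Shape.toProd_injective : Function.Injective (Shape.toProd : Shape L K → _) := by
  intro a b h
  cases a <;> cases b <;>
    first
    | rfl
    | (exfalso; revert h; simp [toProd]; done)
    | (simp only [toProd, Prod.mk.injEq, Sum.inl.injEq, Sum.inr.injEq, true_and] at h
       cases h; rfl)

theorem mk_shape_le (hlam : ℵ₀ ≤ lam) (hK : #K ≤ lam) (hL : L.card ≤ lam) :
    #(Shape L K) ≤ lam := by
  refine (Cardinal.mk_le_of_injective Shape.toProd_injective).trans ?_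
  have h1 : #(ℕ ⊕ K ⊕ L.Symbols) ≤ lam := by
    rw [Cardinal.mk_sum, Cardinal.mk_nat, Cardinal.lift_aleph0, Cardinal.lift_uzero,
      ← Cardinal.add_def]
    exact Cardinal.add_le_of_le hlam hlam (Cardinal.add_le_of_le hlam hK hL)
  simp only [Cardinal.mk_prod, Cardinal.lift_uzero]
  refine Cardinal.mul_le_of_le hlam ?_ h1
  simpa using (Cardinal.natCast_lt_aleph0 (n := 12)).le.trans hlam

/-- A W-type has size at most $\lambda$ once $\sum_s\lambda^{|\mathrm{arity}(s)|}\le\lambda$. Here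
there are at most $\lambda$ shapes, each of arity $<\lambda$, and $\lambda^{<\lambda}=\lambda$. -/
theorem mk_code_le [LinearOrder K] (hlam : ℵ₀ ≤ lam) (hpow : lam ^< lam = lam) (hK : #K ≤ lam)
    (hIio : ∀ k : K, #(Set.Iio k) < lam) (hL : L.card ≤ lam) : #(Code L K) ≤ lam := by
  refine WType.cardinalMk_le_of_le ?_
  have key : ∀ c : Cardinal.{u}, c < lam → lam ^ c ≤ lam := fun c hc =>
    (Cardinal.le_powerlt lam hc).trans hpow.le
  have fin : ∀ n : ℕ, #(ULift.{u} (Fin n)) < lam := fun n => by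
    simpa using (Cardinal.natCast_lt_aleph0 (n := n)).trans_le hlam
  have h0 : #PEmpty.{u + 1} < lam := by simpa using Cardinal.aleph0_pos.trans_le hlam
  have h1 : #PUnit.{u + 1} < lam := by simpa using Cardinal.one_lt_aleph0.trans_le hlam
  have h : ∀ a : Shape L K, lam ^ #a.Arity ≤ lam := by
    intro a
    refine key _ ?_
    cases a
    · exact h0
    · exact h0
    · exact h1
    · exact fin 2
    · exact fin _
    · exact fin _
    · exact h0
    · exact fin 2
    · exact h1
    · exact h1
    · exact hIio _
    · exact fin _
  calc (Cardinal.sum fun a : Shape L K => lam ^ #a.Arity)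
      ≤ Cardinal.sum fun _ : Shape L K => lam := Cardinal.sum_le_sum _ _ h
    _ = #(Shape L K) * lam := Cardinal.sum_const' _ _
    _ ≤ lam := Cardinal.mul_le_of_le hlam (mk_shape_le hlam hK hL) le_rfl

end CodeCardinality

/-! ### First-order definability inside the codes -/

section Representable

variable {L : FirstOrder.Language.{u, u}} {K : Type u} [LinearOrder K] {H : Type*}
  [L.Structure H] (I : Interp K H)

variable (L) in
/-- The symbols of `L'` are represented by operations on the codes for `L`. -/
structure Representable (L' : FirstOrder.Language) [L'.Structure H] : Prop where
  fn : ∀ {n : ℕ} (f : L'.Functions n) (s : Fin n → Code L K), ∃ c : Code L K, ∀ v,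
    I.eval c v = FirstOrder.Language.Structure.funMap f fun i => I.eval (s i) v
  rel : ∀ {n : ℕ} (R : L'.Relations n) (s : Fin n → Code L K), ∃ c : Code L K, ∀ v,
    I.eval c v = I.tv (FirstOrder.Language.Structure.RelMap R fun i => I.eval (s i) v)

theorem representable_self : Representable L I L :=
  ⟨fun f s => ⟨Code.fn f s, fun _ => rfl⟩, fun R s => ⟨Code.rel R s, fun _ => rfl⟩⟩

variable {I} {L' : FirstOrder.Language} [L'.Structure H] (hI : Representable L I L')
include hI

theorem Representable.exists_code_term {β : Type*} (t : L'.Term β) (s : β → Code L K) :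
    ∃ c : Code L K, ∀ v, I.eval c v = t.realize fun b => I.eval (s b) v := by
  induction t with
  | var b => exact ⟨s b, fun _ => rfl⟩
  | func f ts ih =>
    choose c hc using ih
    obtain ⟨d, hd⟩ := hI.fn f c
    refine ⟨d, fun v => ?_⟩
    rw [hd, FirstOrder.Language.Term.realize_func]
    congr 1
    funext i
    exact hc i v

/-- Variable `0` of the assignment serves as the bound variable of each quantifier; all codes
substituted from outside are shifted past it. -/
theorem Representable.exists_code_formula {β : Type*} {k : ℕ} (φ : L'.BoundedFormula β k)
    (s : β → Code L K) (p : Fin k → Code L K) :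
    ∃ c : Code L K, ∀ v, I.eval c v =
      I.tv (φ.Realize (fun b => I.eval (s b) v) fun i => I.eval (p i) v) := by
  have term : ∀ {k : ℕ} (t : L'.Term (β ⊕ Fin k)) (s : β → Code L K) (p : Fin k → Code L K),
      ∃ c : Code L K, ∀ v, I.eval c v =
        t.realize (Sum.elim (fun b => I.eval (s b) v) fun i => I.eval (p i) v) := by
    intro k t s p
    obtain ⟨c, hc⟩ := hI.exists_code_term t (Sum.elim s p)
    refine ⟨c, fun v => ?_⟩
    rw [hc]
    congr 1
    funext b
    cases b <;> rfl
  induction φ generalizing s with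
  | falsum => exact ⟨Code.bot, fun v => by simp [FirstOrder.Language.BoundedFormula.Realize, tv]⟩
  | equal t₁ t₂ =>
    obtain ⟨c₁, h₁⟩ := term t₁ s p
    obtain ⟨c₂, h₂⟩ := term t₂ s p
    exact ⟨c₁.eq c₂, fun v => by simp [FirstOrder.Language.BoundedFormula.Realize, h₁, h₂]⟩
  | rel R ts =>
    choose c hc using fun i => term (ts i) s p
    obtain ⟨d, hd⟩ := hI.rel R c
    refine ⟨d, fun v => ?_⟩
    simp [hd, hc, FirstOrder.Language.BoundedFormula.Realize]
  | imp φ₁ φ₂ ih₁ ih₂ =>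
    obtain ⟨c₁, h₁⟩ := ih₁ s p
    obtain ⟨c₂, h₂⟩ := ih₂ s p
    refine ⟨c₁.imp c₂, fun v => ?_⟩
    simp [h₁, h₂, tv_eq_tt]
  | all φ ih =>
    obtain ⟨c, hc⟩ := ih (fun b => (s b).shift) (Fin.snoc (fun i => (p i).shift) (Code.var 0))
    refine ⟨c.all, fun v => ?_⟩
    rw [eval_all]
    congr 1
    simp only [hc, tv_eq_tt, FirstOrder.Language.BoundedFormula.realize_all, eq_iff_iff]
    refine forall_congr' fun z => iff_of_eq ?_
    congr 1
    funext i
    refine Fin.lastCases ?_ (fun j => ?_) i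
    · simp [prepend]
    · simp

theorem Representable.exists_code_least {n : ℕ} (φ : L'.Formula (Fin (n + 1)))
    (s : Fin n → Code L K) : ∃ c : Code L K, ∀ v, I.eval c v =
      I.sk fun z => φ.Realize (Fin.cons z fun i => I.eval (s i) v : Fin (n + 1) → H) := by
  obtain ⟨c, hc⟩ := hI.exists_code_formula φ
    (Fin.cons (Code.var 0) fun i => (s i).shift : Fin (n + 1) → Code L K) Fin.elim0
  refine ⟨c.least, fun v => ?_⟩
  rw [eval_least]
  congr 1
  funext z
  rw [hc, tv_eq_tt, FirstOrder.Language.Formula.Realize]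
  congr 1
  · funext i
    refine Fin.cases ?_ (fun j => ?_) i <;> simp [prepend]
  · funext i
    exact i.elim0

end Representable

/-! ### Hulls, elementarity and isomorphisms between hulls -/

section Hull

variable {L : FirstOrder.Language.{u, u}} {K : Type u} [LinearOrder K] {H : Type*}
  [L.Structure H] (I : Interp K H)

/-- A set closed under the Skolem functions given by least witnesses. -/
def SkClosed (L' : FirstOrder.Language) [L'.Structure H] (S : Set H) : Prop :=
  ∀ (n : ℕ) (φ : L'.Formula (Fin (n + 1))) (a : Fin n → H), (∀ i, a i ∈ S) →
    I.sk (fun z => φ.Realize (Fin.cons z a : Fin (n + 1) → H)) ∈ S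

variable {I} in
theorem SkClosed.inter {L' : FirstOrder.Language} [L'.Structure H] {S T : Set H}
    (hS : SkClosed I L' S) (hT : SkClosed I L' T) : SkClosed I L' (S ∩ T) :=
  fun n φ a ha => ⟨hS n φ a fun i => (ha i).1, hT n φ a fun i => (ha i).2⟩

variable {I} in
theorem SkClosed.funMap_mem {L' : FirstOrder.Language} [L'.Structure H] {S : Set H}
    (hS : SkClosed I L' S) {n : ℕ} (f : L'.Functions n) (a : Fin n → H) (ha : ∀ i, a i ∈ S) :
    FirstOrder.Language.Structure.funMap f a ∈ S := by
  let φ : L'.Formula (Fin (n + 1)) :=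
    FirstOrder.Language.Term.equal (FirstOrder.Language.Term.var 0)
      (FirstOrder.Language.Term.func f fun i => FirstOrder.Language.Term.var i.succ)
  have h := I.sk_spec (p := fun z => φ.Realize (Fin.cons z a : Fin (n + 1) → H))
    ⟨FirstOrder.Language.Structure.funMap f a, by simp [φ]⟩
  have hmem := hS n φ a ha
  generalize I.sk (fun z => φ.Realize (Fin.cons z a : Fin (n + 1) → H)) = z at h hmem
  simp only [φ, FirstOrder.Language.Formula.realize_equal, FirstOrder.Language.Term.realize_var,
    Fin.cons_zero, FirstOrder.Language.Term.realize_func, Fin.cons_succ] at h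
  rwa [← h]

variable {I} in
theorem SkClosed.exists_realize {L' : FirstOrder.Language} [L'.Structure H] {S : Set H}
    (hS : SkClosed I L' S) {n : ℕ} (φ : L'.BoundedFormula Empty (n + 1)) (x : Fin n → H)
    (hx : ∀ i, x i ∈ S) (a : H) (h : φ.Realize default (Fin.snoc x a : Fin (n + 1) → H)) :
    ∃ b ∈ S, φ.Realize default (Fin.snoc x b : Fin (n + 1) → H) := by
  let ψ : L'.Formula (Fin (n + 1)) :=
    (φ.toFormula.relabel (Sum.elim Empty.elim (fun i : Fin (n + 1) =>
      (Fin.snoc Fin.succ 0 : Fin (n + 1) → Fin (n + 1)) i)))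
  have hψ : ∀ z, ψ.Realize (Fin.cons z x : Fin (n + 1) → H) ↔
      φ.Realize default (Fin.snoc x z : Fin (n + 1) → H) := by
    intro z
    simp only [ψ, FirstOrder.Language.Formula.realize_relabel,
      FirstOrder.Language.BoundedFormula.realize_toFormula]
    refine iff_of_eq ?_
    congr 1
    · funext e; exact e.elim
    · funext i
      refine Fin.lastCases ?_ (fun j => ?_) i <;> simp
  exact ⟨_, hS n ψ x hx, (hψ _).1 (I.sk_spec
    (p := fun z => ψ.Realize (Fin.cons z x : Fin (n + 1) → H)) ⟨a, (hψ a).2 h⟩)⟩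

-- Tarski–Vaught: the least witness of a satisfiable formula with parameters in `S` lies in `S`.
variable {I} in
theorem SkClosed.exists_elementarySubstructure {L' : FirstOrder.Language} [L'.Structure H]
    {S : Set H} (hS : SkClosed I L' S) :
    ∃ N : L'.ElementarySubstructure H, (N : Set H) = S := by
  let N : L'.Substructure H :=
    { carrier := S
      fun_mem := fun f a ha => hS.funMap_mem f a ha }
  refine ⟨N.toElementarySubstructure fun n φ x a h => ?_, rfl⟩
  obtain ⟨b, hb, h'⟩ := hS.exists_realize φ (fun i => x i) (fun i => (x i).2) a h
  exact ⟨⟨b, hb⟩, h'⟩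

-- This form yields $N_u\cap N_v\prec N_{u\cap v}$: witnesses are found in `S` for truth in the big
-- structure, and truth in `N` agrees with it.
variable {I} in
theorem SkClosed.exists_elementarySubstructure_of_subset {L' : FirstOrder.Language}
    [L'.Structure H] {S : Set H} (hS : SkClosed I L' S) (N : L'.ElementarySubstructure H)
    (hSN : S ⊆ N) :
    ∃ M : L'.ElementarySubstructure N, Subtype.val '' (M : Set N) = S := by
  let M : L'.Substructure N :=
    { carrier := Subtype.val ⁻¹' S
      fun_mem := fun f a ha => hS.funMap_mem f (fun i => a i) ha }
  refine ⟨M.toElementarySubstructure fun n φ x a h => ?_, ?_⟩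
  · have hsnoc : ∀ z : N, (N.subtype ∘ (Fin.snoc ((↑) ∘ x) z : Fin (n + 1) → N)) =
        (Fin.snoc (fun i => ((x i : N) : H)) (z : H) : Fin (n + 1) → H) := by
      intro z
      funext i
      refine Fin.lastCases ?_ (fun j => ?_) i <;> simp
    have hdef : (N.subtype ∘ (default : Empty → N)) = default := Subsingleton.elim _ _
    rw [← N.subtype.map_boundedFormula, hsnoc, hdef] at h
    obtain ⟨b, hb, h'⟩ := hS.exists_realize φ _ (fun i => (x i).2) _ h
    refine ⟨⟨⟨b, hSN hb⟩, hb⟩, ?_⟩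
    rw [← N.subtype.map_boundedFormula, hsnoc, hdef]
    exact h'
  · exact Set.image_preimage_eq_of_subset fun x hx => ⟨⟨x, hSN hx⟩, rfl⟩

variable (L) in
/-- The codes whose value is invariant under a relation between assignments. -/
def invariantCodes (E : (ℕ → H) → (ℕ → H) → Prop) : Set (Code L K) :=
  {t | ∀ v v', E v v' → I.eval t v = I.eval t v'}

variable (L) in
/-- The values at `v` of the codes whose value is invariant under `E`. -/
def hull (E : (ℕ → H) → (ℕ → H) → Prop) (v : ℕ → H) : Set H :=
  {x | ∃ t ∈ invariantCodes L I E, I.eval t v = x}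

variable (E : (ℕ → H) → (ℕ → H) → Prop) (v : ℕ → H)

-- A definable least witness of code values is again a code value, and it is invariant under `E`
-- because it depends only on the values of its invariant subcodes.
variable {I} in
theorem Representable.skClosed_hull {L' : FirstOrder.Language} [L'.Structure H]
    (hI : Representable L I L') : SkClosed I L' (hull L I E v) := by
  intro n φ a ha
  choose t ht hta using ha
  obtain ⟨c, hc⟩ := hI.exists_code_least φ t
  refine ⟨c, fun w w' hw => ?_, ?_⟩
  · simp only [hc, fun i => ht i w w' hw]
  · simp only [hc, hta]

theorem const_mem_hull (k : K) : I.const k ∈ hull L I E v :=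
  ⟨Code.const k, fun _ _ _ => rfl, rfl⟩

theorem coll_mem_hull (k : K) (f : Set.Iio k → H) (hf : ∀ i, f i ∈ hull L I E v) :
    I.coll k f ∈ hull L I E v := by
  choose t ht hta using hf
  refine ⟨Code.collect k t, fun w w' hw => ?_, ?_⟩
  · simp only [eval_collect, fun i => ht i w w' hw]
  · simp only [eval_collect, hta]

variable (L) in
/-- Two assignments satisfy the same equations between codes. -/
def SameType (v v' : ℕ → H) : Prop :=
  ∀ s t : Code L K, I.eval s v = I.eval t v ↔ I.eval s v' = I.eval t v'

-- The map sends the value of a code at `v` to its value at `v'`. Equality of types makes this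
-- independent of the code and injective.
variable {I v} in
theorem exists_hullEquiv {v' : ℕ → H} (h : SameType L I v v') (N N' : L.ElementarySubstructure H)
    (hN : (N : Set H) = hull L I E v) (hN' : (N' : Set H) = hull L I E v') :
    ∃ e : N ≃[L] N', ∀ t ∈ invariantCodes L I E, ∀ ht : I.eval t v ∈ N,
      (e ⟨I.eval t v, ht⟩ : H) = I.eval t v' := by
  have mem : ∀ x : N, ∃ t ∈ invariantCodes L I E, I.eval t v = x := fun x => by
    have := x.2
    rwa [← SetLike.mem_coe, hN] at this
  have mem' : ∀ x : N', ∃ t ∈ invariantCodes L I E, I.eval t v' = x := fun x => by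
    have := x.2
    rwa [← SetLike.mem_coe, hN'] at this
  choose c hc hcv using mem
  have hmem : ∀ x, I.eval (c x) v' ∈ N' := fun x => by
    rw [← SetLike.mem_coe, hN']
    exact ⟨c x, hc x, rfl⟩
  let g : N → N' := fun x => ⟨I.eval (c x) v', hmem x⟩
  have hg : ∀ (x : N) (t : Code L K), I.eval t v = x → (g x : H) = I.eval t v' := fun x t ht =>
    (h (c x) t).1 ((hcv x).trans ht.symm)
  have hbij : Function.Bijective g := by
    constructor
    · intro x y hxy
      have := (h (c x) (c y)).2 (congrArg Subtype.val hxy)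
      rw [hcv, hcv] at this
      exact Subtype.ext this
    · intro y
      obtain ⟨t, ht, hty⟩ := mem' y
      have htN : I.eval t v ∈ N := by
        rw [← SetLike.mem_coe, hN]
        exact ⟨t, ht, rfl⟩
      exact ⟨⟨_, htN⟩, Subtype.ext ((hg ⟨_, htN⟩ t rfl).trans hty)⟩
  refine ⟨⟨Equiv.ofBijective g hbij, ?_, ?_⟩, fun t _ hN => hg ⟨_, hN⟩ t rfl⟩
  · intro n f x
    refine Subtype.ext ?_
    refine (hg _ (Code.fn f fun i => c (x i)) ?_).trans ?_
    · simp only [eval_fn, hcv]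
      rfl
    · rfl
  · intro n R x
    -- The second code always has the value true, so preservation of `R` becomes preservation of an
    -- equation.
    have := h (Code.rel R fun i => c (x i)) (Code.eq (Code.var 0) (Code.var 0))
    have hy : ∀ p : Prop, I.tv p = I.tv True ↔ p := fun p => by
      rw [I.tv_eq_tt.2 trivial, tv_eq_tt]
    simp only [eval_rel, eval_eq, eval_var, hcv, hy] at this
    exact this.symm

end Hull

theorem mk_Iio_succ_le {ν : Cardinal.{u}} (k : (Order.succ ν).ord.ToType) :
    #(Set.Iio k) ≤ ν :=
  Order.lt_succ_iff.1 ((Cardinal.mk_Iio_lt k (by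
    rw [Ordinal.type_toType, Cardinal.mk_ord_toType])).trans_eq (Cardinal.mk_ord_toType _))

/-! ### End-homogeneous sequences -/

section EndHomogeneous

variable {X K : Type u} [LinearOrder X] [LinearOrder K]
  {Col : Type u} (c : List X → X → Col)

/-- The elements above `f i`, `i < k`, which have the same colours over these points as `δ`. -/
def sameColourSet (δ : X) (k : K) (f : K → X) : Set X :=
  {x | (∀ i < k, f i < x) ∧
    ∀ l : List K, (∀ i ∈ l, i < k) → c (l.map f) x = c (l.map f) δ}

variable {c} in
theorem sameColourSet_subset {δ δ' : X} {k : K} {f f' : K → X} (h : ∀ i < k, f i = f' i)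
    (hc : ∀ l : List K, (∀ i ∈ l, i < k) → c (l.map f) δ = c (l.map f') δ') :
    sameColourSet c δ k f ⊆ sameColourSet c δ' k f' := by
  rintro x ⟨h1, h2⟩
  refine ⟨fun i hi => h i hi ▸ h1 i hi, fun l hl => ?_⟩
  have : l.map f = l.map f' := List.map_congr_left fun i hi => h i (hl i hi)
  rw [← hc l hl, ← h2 l hl, this]

variable [WellFoundedLT X] [WellFoundedLT K]

open Classical in
/-- The canonical increasing sequence of elements with the same colours as `δ` over their
predecessors. -/
noncomputable def endHomSeq (δ : X) : K → X :=
  wellFounded_lt.fix fun k rec =>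
    if h : (sameColourSet c δ k fun i => if hi : i < k then rec i hi else δ).Nonempty then
      wellFounded_lt.min _ h else δ

open Classical in
theorem endHomSeq_eq (δ : X) (k : K) : endHomSeq c δ k =
    if h : (sameColourSet c δ k (endHomSeq c δ)).Nonempty then wellFounded_lt.min _ h else δ := by
  have : (sameColourSet c δ k fun i => if _ : i < k then endHomSeq c δ i else δ) =
      sameColourSet c δ k (endHomSeq c δ) := by
    have h : ∀ i < k, (if _ : i < k then endHomSeq c δ i else δ) = endHomSeq c δ i :=
      fun i hi => by simp [hi]
    have h' : ∀ l : List K, (∀ i ∈ l, i < k) →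
        l.map (fun i => if _ : i < k then endHomSeq c δ i else δ) = l.map (endHomSeq c δ) :=
      fun l hl => List.map_congr_left fun i hi => h i (hl i hi)
    exact (sameColourSet_subset h fun l hl => by rw [h' l hl]).antisymm
      (sameColourSet_subset (fun i hi => (h i hi).symm) fun l hl => by rw [h' l hl])
  rw [endHomSeq, WellFounded.fix_eq]
  simp only [← endHomSeq.eq_1]
  simp only [this]

theorem mem_sameColourSet_self {δ : X} {k : K} (h : ∀ i < k, endHomSeq c δ i < δ) :
    δ ∈ sameColourSet c δ k (endHomSeq c δ) := ⟨h, fun _ _ => rfl⟩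

theorem endHomSeq_mem {δ : X} {k : K} (h : ∀ i < k, endHomSeq c δ i < δ) :
    endHomSeq c δ k ∈ sameColourSet c δ k (endHomSeq c δ) := by
  have hne : (sameColourSet c δ k (endHomSeq c δ)).Nonempty := ⟨δ, mem_sameColourSet_self c h⟩
  have := WellFounded.min_mem wellFounded_lt _ hne
  rwa [endHomSeq_eq, dif_pos hne]

theorem endHomSeq_le {δ : X} {k : K} (h : ∀ i < k, endHomSeq c δ i < δ) :
    endHomSeq c δ k ≤ δ := by
  have hne : (sameColourSet c δ k (endHomSeq c δ)).Nonempty := ⟨δ, mem_sameColourSet_self c h⟩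
  rw [endHomSeq_eq, dif_pos hne]
  exact not_lt.1 (WellFounded.not_lt_min wellFounded_lt _ (mem_sameColourSet_self c h))

/-- Each term is the minimum of a set determined by the earlier terms and by colours, so the colour
pattern reconstructs the sequence by induction. -/
theorem endHomSeq_congr {δ δ' : X} {k : K} (hδ : ∀ i < k, endHomSeq c δ i < δ)
    (hc : ∀ l : List K, (∀ i ∈ l, i < k) →
      c (l.map (endHomSeq c δ)) δ = c (l.map (endHomSeq c δ')) δ') :
    ∀ i ≤ k, endHomSeq c δ i = endHomSeq c δ' i := by
  intro i
  induction i using WellFoundedLT.induction with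
  | _ i ih =>
    intro hi
    have hS : sameColourSet c δ i (endHomSeq c δ) = sameColourSet c δ' i (endHomSeq c δ') :=
      (sameColourSet_subset (fun j hj => ih j hj (hj.le.trans hi)) fun l hl =>
        hc l fun j hj => (hl j hj).trans_le hi).antisymm
      (sameColourSet_subset (fun j hj => (ih j hj (hj.le.trans hi)).symm) fun l hl =>
        (hc l fun j hj => (hl j hj).trans_le hi).symm)
    have hne : (sameColourSet c δ i (endHomSeq c δ)).Nonempty :=
      ⟨δ, mem_sameColourSet_self c fun j hj => hδ j (hj.trans_le hi)⟩
    rw [endHomSeq_eq, endHomSeq_eq, dif_pos hne, dif_pos (hS ▸ hne)]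
    simp only [hS]

/-- A well-ordered set with more than `2 ^ ν` elements contains, for every colouring of finite
tuples with at most `2 ^ ν` colours, an increasing sequence of length `ν⁺` such that the colours
do not depend on the last element of the tuple. -/
theorem exists_endHomogeneous {ν : Cardinal.{u}} (hν : ℵ₀ ≤ ν) (hX : 2 ^ ν < #X)
    (hCol : #Col ≤ 2 ^ ν) :
    ∃ (δ : X) (α : (Order.succ ν).ord.ToType → X), StrictMono α ∧ (∀ k, α k < δ) ∧
      ∀ k, ∀ l : List (Order.succ ν).ord.ToType, (∀ i ∈ l, i < k) →
        c (l.map α) (α k) = c (l.map α) δ := by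
  set K := (Order.succ ν).ord.ToType with hK
  by_cases H : ∃ δ : X, ∀ k : K, endHomSeq c δ k < δ
  · obtain ⟨δ, hδ⟩ := H
    have hmem := fun k => endHomSeq_mem c fun i (_ : i < k) => hδ i
    exact ⟨δ, endHomSeq c δ, fun i k hik => (hmem k).1 i hik, hδ, fun k l hl => (hmem k).2 l hl⟩
  -- Otherwise the canonical sequence of every `δ` reaches `δ` at some stage. That stage and the
  -- colours over the earlier terms determine `δ`, and there are at most $2^\nu$ such data.
  exfalso
  push Not at H
  have hlen : ∀ δ : X, ∃ k : K, (∀ i < k, endHomSeq c δ i < δ) ∧ endHomSeq c δ k = δ := by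
    intro δ
    obtain ⟨k, hk, hmin⟩ := WellFounded.has_min (wellFounded_lt (α := K))
      {k | δ ≤ endHomSeq c δ k} (H δ)
    have h : ∀ i < k, endHomSeq c δ i < δ := fun i hi => not_le.1 fun h => hmin i h hi
    exact ⟨k, h, (endHomSeq_le c h).antisymm hk⟩
  choose k hlt heq using hlen
  let g : ∀ (_ : X) (k : K), List (Set.Iio k) → Col :=
    fun δ k l => c (l.map fun i => endHomSeq c δ i.1) δ
  let Φ : X → Σ k : K, (List (Set.Iio k) → Col) := fun δ => ⟨k δ, g δ (k δ)⟩
  have hΦ : Function.Injective Φ := by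
    intro δ δ' h
    obtain ⟨h1, h2⟩ := Sigma.mk.inj_iff.1 h
    have heq' := heq δ'
    rw [← h1] at h2 heq'
    have h3 := eq_of_heq h2
    rw [← heq δ, ← heq']
    refine endHomSeq_congr c (hlt δ) (fun l hl => ?_) _ le_rfl
    have hmap : ∀ f : K → X, (l.pmap Subtype.mk hl).map (fun i => f i.1) = l.map f := fun f => by
      rw [List.map_pmap, List.pmap_eq_map]
    have := congrFun h3 (l.pmap Subtype.mk hl)
    exact (congrArg (c · δ) (hmap (endHomSeq c δ))).symm.trans
      (this.trans (congrArg (c · δ') (hmap (endHomSeq c δ'))))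
  have hν2 : ν ≤ 2 ^ ν := (Cardinal.cantor ν).le
  have h2ν : ℵ₀ ≤ (2 : Cardinal.{u}) ^ ν := hν.trans hν2
  refine (Cardinal.mk_le_of_injective hΦ).not_gt (lt_of_le_of_lt ?_ hX)
  rw [Cardinal.mk_sigma]
  have hterm : ∀ k : K, #(List (Set.Iio k) → Col) ≤ 2 ^ ν := by
    intro k
    have h1 : #(Set.Iio k) ≤ ν := mk_Iio_succ_le k
    have h2 : #(List (Set.Iio k)) ≤ ν :=
      (Cardinal.mk_list_le_max _).trans (max_le hν h1)
    calc #(List (Set.Iio k) → Col) = #Col ^ #(List (Set.Iio k)) := by simp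
      _ ≤ (2 ^ ν) ^ #(List (Set.Iio k)) := Cardinal.power_le_power_right hCol
      _ ≤ (2 ^ ν) ^ ν := Cardinal.power_le_power_left (Cardinal.aleph0_pos.trans_le h2ν).ne' h2
      _ = 2 ^ ν := by rw [← Cardinal.power_mul, Cardinal.mul_eq_self hν]
  calc (Cardinal.sum fun k : K => #(List (Set.Iio k) → Col))
      ≤ Cardinal.sum fun _ : K => 2 ^ ν := Cardinal.sum_le_sum _ _ hterm
    _ = #K * 2 ^ ν := Cardinal.sum_const' _ _
    _ ≤ 2 ^ ν := Cardinal.mul_le_of_le h2ν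
        (by rw [hK, Cardinal.mk_ord_toType]; exact Order.succ_le_of_lt (Cardinal.cantor ν)) le_rfl

end EndHomogeneous

/-! ### The Erdős–Rado homogeneous sequence -/

section Homogeneous

variable {κ : Cardinal.{u}}

/-- The order type of `S` has cardinality at least $\kappa$, hence is at least the initial ordinal
of $\kappa$. -/
theorem exists_strictMono_mem {κ : Cardinal.{u}} {S : Set κ.ord.ToType} (hS : κ ≤ #S) :
    ∃ e : κ.ord.ToType → κ.ord.ToType, StrictMono e ∧ ∀ k, e k ∈ S := by
  have h : Ordinal.type (fun a b : κ.ord.ToType => a < b) ≤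
      Ordinal.type (fun a b : S => a < b) := by
    rw [Ordinal.type_toType, Cardinal.ord_le, Ordinal.card_type]
    exact hS
  obtain ⟨f⟩ := Ordinal.type_le_iff'.1 h
  exact ⟨fun k => f k, fun i j hij => f.map_rel_iff.2 hij, fun k => (f k).2⟩

/-- A set of `κ⁺` indices contains, for a function with at most `κ` values, `κ⁺` indices where
the function is constant. -/
theorem exists_subset_const {A : Type u} (hκ : ℵ₀ ≤ κ) (hA : #A ≤ κ)
    {S : Set (Order.succ κ).ord.ToType} (hS : Order.succ κ ≤ #S)
    (f : (Order.succ κ).ord.ToType → A) :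
    ∃ S' ⊆ S, Order.succ κ ≤ #S' ∧ ∃ a, ∀ k ∈ S', f k = a := by
  obtain ⟨a, S', h, h1, h2⟩ := Cardinal.infinite_pigeonhole_set (fun k : S => f k) (Order.succ κ)
    hS (hκ.trans (Order.le_succ κ))
    (by rw [(Cardinal.isRegular_succ hκ).cof_ord]; exact Order.lt_succ_of_le hA)
  exact ⟨S', h, h1, a, h2⟩

theorem succ_le_mk_inter_Ioi (hκ : ℵ₀ ≤ κ) {S : Set (Order.succ κ).ord.ToType}
    (hS : Order.succ κ ≤ #S) (z : (Order.succ κ).ord.ToType) :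
    Order.succ κ ≤ #(S ∩ Set.Ioi z : Set _) := by
  by_contra! H
  have h1 : #(Set.Iio z) ≤ κ := mk_Iio_succ_le z
  have h2 : S ⊆ (S ∩ Set.Ioi z) ∪ insert z (Set.Iio z) := by
    intro x hx
    rcases lt_trichotomy x z with h | h | h
    · exact .inr (.inr h)
    · exact .inr (.inl h)
    · exact .inl ⟨hx, h⟩
  have h3 : #S ≤ κ := by
    refine (Cardinal.mk_le_mk_of_subset h2).trans ((Cardinal.mk_union_le _ _).trans ?_)
    refine Cardinal.add_le_of_le hκ (Order.lt_succ_iff.1 H) ?_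
    exact Cardinal.mk_insert_le.trans
      (Cardinal.add_le_of_le hκ h1 (Cardinal.one_lt_aleph0.le.trans hκ))
  exact (Order.lt_succ_of_le h3).not_ge hS

/-- The form of the Erdős–Rado theorem that is used: in a sequence of length `κ⁺`, with one
additional first point, `tp` is constant on triples, on quadruples it depends only on the first
two points and is constant if the first point is fixed, and `val` depends only on the first point
of a triple. -/
theorem exists_homogeneous (hκ : ℵ₀ ≤ κ) {X : Type u} [LinearOrder X] [WellFoundedLT X]
    (hX : (2 : Cardinal.{u}) ^ ((2 : Cardinal.{u}) ^ κ) < #X) {A B : Type u} (hA : #A ≤ κ)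
    (hB : #B ≤ 2 ^ κ) (tp : List X → A) (val : List X → B) :
    ∃ a : WithBot (Order.succ κ).ord.ToType → X, StrictMono a ∧
      (∀ h i j h' i' j', h < i → i < j → h' < i' → i' < j' →
        tp [a h, a i, a j] = tp [a h', a i', a j']) ∧
      (∀ h i j k j' k', h < i → i < j → j < k → i < j' → j' < k' →
        tp [a h, a i, a j, a k] = tp [a h, a i, a j', a k']) ∧
      (∀ i j k i' j' k', ⊥ < i → i < j → j < k → ⊥ < i' → i' < j' → j' < k' →
        tp [a ⊥, a i, a j, a k] = tp [a ⊥, a i', a j', a k']) ∧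
      (∀ h i j i' j', h < i → i < j → h < i' → i' < j' →
        val [a h, a i, a j] = val [a h, a i', a j']) := by
  have hκ2 : ℵ₀ ≤ (2 : Cardinal.{u}) ^ κ := hκ.trans (Cardinal.cantor κ).le
  have hAB : #(A × B) ≤ 2 ^ κ := by
    rw [Cardinal.mk_prod, Cardinal.lift_id, Cardinal.lift_id]
    exact Cardinal.mul_le_of_le hκ2 (hA.trans (Cardinal.cantor κ).le) hB
  let c : List X → X → A × B := fun l x => (tp (l ++ [x]), val (l ++ [x]))
  -- The first round, of length $(2^\kappa)^+$, makes the last point of a tuple irrelevant. The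
  -- second, of length $\kappa^+$, does the same for the last but one: triples then depend on one
  -- point, quadruples on two.
  obtain ⟨δ, α, hα, -, hαc⟩ := exists_endHomogeneous (ν := 2 ^ κ) c hκ2 hX
    (hAB.trans (Cardinal.cantor _).le)
  let c' : List (Order.succ ((2 : Cardinal.{u}) ^ κ)).ord.ToType → _ → A × B := fun l x => c ((l ++ [x]).map α) δ
  obtain ⟨ε, β, hβ, -, hβc⟩ := exists_endHomogeneous (ν := κ) c' hκ
    (by rw [Cardinal.mk_ord_toType]; exact Order.lt_succ _) hAB
  have key : ∀ (l : List (Order.succ κ).ord.ToType) (i j), (∀ x ∈ l, x < i) → i < j →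
      c (((l.map β) ++ [β i]).map α) (α (β j)) = c' (l.map β) ε := by
    intro l i j hl hij
    rw [hαc, ← hβc i l hl]
    intro x hx
    rcases List.mem_append.1 hx with hx | hx
    · obtain ⟨y, hy, rfl⟩ := List.mem_map.1 hx
      exact hβ ((hl y hy).trans hij)
    · rw [List.mem_singleton.1 hx]
      exact hβ hij
  have key3 : ∀ h i j, h < i → i < j →
      c [α (β h), α (β i)] (α (β j)) = c' [β h] ε := fun h i j hhi hij =>
    key [h] i j (by simpa using hhi) hij
  have key4 : ∀ h i j k, h < i → i < j → j < k →
      c [α (β h), α (β i), α (β j)] (α (β k)) = c' [β h, β i] ε := fun h i j k hhi hij hjk =>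
    key [h, i] j k (by simpa using ⟨hhi.trans hij, hij⟩) hjk
  -- Only the type component has at most $\kappa$ colours, so only it can be made constant by the
  -- pigeonhole.
  obtain ⟨S, -, hS, a₀, ha₀⟩ := exists_subset_const hκ hA (S := Set.univ)
    (by rw [Cardinal.mk_univ, Cardinal.mk_ord_toType]) fun h => (c' [β h] ε).1
  have hSne : S.Nonempty := by
    rw [← Set.nonempty_coe_sort, ← Cardinal.mk_ne_zero_iff]
    exact ((Cardinal.succ_pos κ).trans_le hS).ne'
  obtain ⟨z, hz⟩ := hSne
  -- The point `z` becomes the extra first point. With it fixed, the type of a quadruple depends on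
  -- one index only, and a second pigeonhole applies.
  obtain ⟨S', hS'S, hS', a₁, ha₁⟩ := exists_subset_const hκ hA (succ_le_mk_inter_Ioi hκ hS z)
    fun i => (c' [β z, β i] ε).1
  obtain ⟨e, he, heS⟩ := exists_strictMono_mem hS'
  let e' : WithBot (Order.succ κ).ord.ToType → (Order.succ κ).ord.ToType := fun w => WithBot.recBotCoe z e w
  have he' : StrictMono e' := by
    intro x y hxy
    induction y using WithBot.recBotCoe with
    | bot => exact absurd hxy not_lt_bot
    | coe y =>
      induction x using WithBot.recBotCoe with
      | bot => exact (hS'S (heS y)).2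
      | coe x => exact he (WithBot.coe_lt_coe.1 hxy)
  have heS : ∀ w, e' w ∈ S := by
    intro w
    induction w using WithBot.recBotCoe with
    | bot => exact hz
    | coe w => exact (hS'S (heS w)).1
  have heS' : ∀ w, ⊥ < w → e' w ∈ S' := by
    intro w hw
    induction w using WithBot.recBotCoe with
    | bot => exact absurd hw (lt_irrefl _)
    | coe w => exact ‹∀ k, e k ∈ S'› w
  refine ⟨fun w => α (β (e' w)), fun x y h => hα (hβ (he' h)), ?_, ?_, ?_, ?_⟩
  · intro h i j h' i' j' h1 h2 h3 h4
    have e1 := congrArg Prod.fst (key3 _ _ _ (he' h1) (he' h2))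
    have e2 := congrArg Prod.fst (key3 _ _ _ (he' h3) (he' h4))
    exact e1.trans ((ha₀ _ (heS h)).trans ((ha₀ _ (heS h')).symm.trans e2.symm))
  · intro h i j k j' k' h1 h2 h3 h4 h5
    exact congrArg Prod.fst ((key4 _ _ _ _ (he' h1) (he' h2) (he' h3)).trans
      (key4 _ _ _ _ (he' h1) (he' h4) (he' h5)).symm)
  · intro i j k i' j' k' h1 h2 h3 h4 h5 h6
    have e1 := congrArg Prod.fst (key4 _ _ _ _ (he' h1) (he' h2) (he' h3))
    have e2 := congrArg Prod.fst (key4 _ _ _ _ (he' h4) (he' h5) (he' h6))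
    exact e1.trans ((ha₁ _ (heS' i h1)).trans ((ha₁ _ (heS' i' h4)).symm.trans e2.symm))
  · intro h i j i' j' h1 h2 h3 h4
    exact congrArg Prod.snd ((key3 _ _ _ (he' h1) (he' h2)).trans
      (key3 _ _ _ (he' h3) (he' h4)).symm)

end Homogeneous

/-! ### The three kinds of hull and their intersections -/

section Hulls

variable {L : FirstOrder.Language.{u, u}} {K : Type u} [LinearOrder K] {H : Type*}
  [L.Structure H] (I : Interp K H)

/-- The value of a code at a pair. -/
noncomputable def ev2 (t : Code L K) (x y : H) : H := I.eval t (pad I.ff ![x, y])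
/-- The value of a code at a triple. -/
noncomputable def ev3 (t : Code L K) (x y z : H) : H := I.eval t (pad I.ff ![x, y, z])
/-- The value of a code at a quadruple. -/
noncomputable def ev4 (t : Code L K) (x y z w : H) : H := I.eval t (pad I.ff ![x, y, z, w])

/-- The code of the substitution of two variables. -/
def sel2 (t : Code L K) {k : ℕ} (m n : Fin k) : Code L K := t.app ![Code.var m, Code.var n]
/-- The code of the substitution of three variables. -/
def sel3 (t : Code L K) {k : ℕ} (m n p : Fin k) : Code L K :=
  t.app ![Code.var m, Code.var n, Code.var p]

theorem eval_sel2 (t : Code L K) {k : ℕ} (m n : Fin k) (v : Fin k → H) :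
    I.eval (sel2 t m n) (pad I.ff v) = ev2 I t (v m) (v n) := by
  rw [sel2, eval_app, ev2]
  congr 2
  funext i
  fin_cases i <;> simp [pad_of_lt]

theorem eval_sel3 (t : Code L K) {k : ℕ} (m n p : Fin k) (v : Fin k → H) :
    I.eval (sel3 t m n p) (pad I.ff v) = ev3 I t (v m) (v n) (v p) := by
  rw [sel3, eval_app, ev3]
  congr 2
  funext i
  fin_cases i <;> simp [pad_of_lt]

theorem ev3_sel2 (t : Code L K) (m n : Fin 3) (x y z : H) :
    ev3 I (sel2 t m n) x y z = ev2 I t (![x, y, z] m) (![x, y, z] n) := eval_sel2 I t m n _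

theorem ev4_sel2 (t : Code L K) (m n : Fin 4) (x y z w : H) :
    ev4 I (sel2 t m n) x y z w = ev2 I t (![x, y, z, w] m) (![x, y, z, w] n) :=
  eval_sel2 I t m n _

theorem ev4_sel3 (t : Code L K) (m n p : Fin 4) (x y z w : H) :
    ev4 I (sel3 t m n p) x y z w =
      ev3 I t (![x, y, z, w] m) (![x, y, z, w] n) (![x, y, z, w] p) := eval_sel3 I t m n p _

variable {Ω : Type*} [LinearOrder Ω]

/-- The code depends only on the second point of a triple. -/
def DependsOnMiddle (a : Ω → H) (t : Code L K) : Prop :=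
  ∀ ⦃h i j h' j' : Ω⦄, h < i → i < j → h' < i → i < j' →
    ev3 I t (a h) (a i) (a j) = ev3 I t (a h') (a i) (a j')

/-- The code is constant on triples. -/
def ConstantOnTriples (a : Ω → H) (t : Code L K) : Prop :=
  ∀ ⦃h i j h' i' j' : Ω⦄, h < i → i < j → h' < i' → i' < j' →
    ev3 I t (a h) (a i) (a j) = ev3 I t (a h') (a i') (a j')

variable (L)

/-- The values of the codes which are constant on triples. -/
def hull0 (a : Ω → H) : Set H :=
  {x | ∃ t : Code L K, ConstantOnTriples I a t ∧
    ∀ ⦃h i j⦄, h < i → i < j → ev3 I t (a h) (a i) (a j) = x}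

/-- The values at `i` of the codes which depend only on the second point of a triple. -/
def hull1 (a : Ω → H) (i : Ω) : Set H :=
  {x | ∃ t : Code L K, DependsOnMiddle I a t ∧
    ∀ ⦃h j⦄, h < i → i < j → ev3 I t (a h) (a i) (a j) = x}

/-- The values of the codes at the pair `(i, j)`. -/
def hull2 (a : Ω → H) (i j : Ω) : Set H := {x | ∃ t : Code L K, ev2 I t (a i) (a j) = x}

variable {L I} {a : Ω → H}

theorem mem_hull1_of_left {t : Code L K}
    (h : ∀ ⦃p q q' : Ω⦄, p < q → p < q' → ev2 I t (a p) (a q) = ev2 I t (a p) (a q'))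
    {i j : Ω} (hij : i < j) : ev2 I t (a i) (a j) ∈ hull1 L I a i := by
  refine ⟨sel2 t (1 : Fin 3) 2, fun h₁ p q h' q' _ h2 _ h4 => ?_, fun h' j' _ h2 => ?_⟩
  · simp only [ev3_sel2]
    exact h h2 h4
  · simp only [ev3_sel2]
    exact h h2 hij

theorem mem_hull1_of_right {t : Code L K}
    (h : ∀ ⦃p p' q : Ω⦄, p < q → p' < q → ev2 I t (a p) (a q) = ev2 I t (a p') (a q))
    {i j : Ω} (hij : i < j) : ev2 I t (a i) (a j) ∈ hull1 L I a j := by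
  refine ⟨sel2 t (0 : Fin 3) 1, fun h₁ p q h' q' h2 _ h4 _ => ?_, fun h' j' h2 _ => ?_⟩
  · simp only [ev3_sel2]
    exact h h2 h4
  · simp only [ev3_sel2]
    exact h h2 hij

theorem mem_hull0_of_constant {t : Code L K} (ht : ConstantOnTriples I a t) {h i j : Ω}
    (h1 : h < i) (h2 : i < j) : ev3 I t (a h) (a i) (a j) ∈ hull0 L I a :=
  ⟨t, ht, fun _ _ _ h3 h4 => ht h3 h4 h1 h2⟩

theorem mem_hull0_of_left_right [NoMaxOrder Ω] {t : Code L K}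
    (hl : ∀ ⦃p q q' : Ω⦄, p < q → p < q' → ev2 I t (a p) (a q) = ev2 I t (a p) (a q'))
    (hr : ∀ ⦃p p' q : Ω⦄, p < q → p' < q → ev2 I t (a p) (a q) = ev2 I t (a p') (a q))
    {i j : Ω} (hij : i < j) : ev2 I t (a i) (a j) ∈ hull0 L I a := by
  have key : ∀ ⦃p q p' q' : Ω⦄, p < q → p' < q' →
      ev2 I t (a p) (a q) = ev2 I t (a p') (a q') := by
    intro p q p' q' h1 h2
    -- Raise both upper points to a common `r`, exchange the lower points there, and come back down.
    obtain ⟨r, hr'⟩ := exists_gt (max q q')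
    obtain ⟨h3, h4⟩ := max_lt_iff.1 hr'
    exact (hl h1 (h1.trans h3)).trans ((hr (h1.trans h3) (h2.trans h4)).trans
      (hl (h2.trans h4) h2))
  refine ⟨sel2 t (0 : Fin 3) 1, fun h₁ p q h' p' q' h2 _ h4 _ => ?_, fun h' i' j' h2 _ => ?_⟩
  · simp only [ev3_sel2]
    exact key h2 h4
  · simp only [ev3_sel2]
    exact key h2 hij

variable [OrderBot Ω]

variable (L I) in
/-- The homogeneity of a sequence of points with respect to the values of codes. -/
structure HomogeneousSeq (a : Ω → H) (D : Set H) : Prop where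
  injective : Function.Injective a
  triple : ∀ (s t : Code L K) {h i j h' i' j' : Ω}, h < i → i < j → h' < i' → i' < j' →
    ev3 I s (a h) (a i) (a j) = ev3 I t (a h) (a i) (a j) →
    ev3 I s (a h') (a i') (a j') = ev3 I t (a h') (a i') (a j')
  quadruple : ∀ (s t : Code L K) {h i j k j' k' : Ω}, h < i → i < j → j < k → i < j' → j' < k' →
    ev4 I s (a h) (a i) (a j) (a k) = ev4 I t (a h) (a i) (a j) (a k) →
    ev4 I s (a h) (a i) (a j') (a k') = ev4 I t (a h) (a i) (a j') (a k')
  quadruple_bot : ∀ (s t : Code L K) {i j k i' j' k' : Ω}, ⊥ < i → i < j → j < k →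
    ⊥ < i' → i' < j' → j' < k' →
    ev4 I s (a ⊥) (a i) (a j) (a k) = ev4 I t (a ⊥) (a i) (a j) (a k) →
    ev4 I s (a ⊥) (a i') (a j') (a k') = ev4 I t (a ⊥) (a i') (a j') (a k')
  value : ∀ (t : Code L K) {h i j i' j' : Ω}, h < i → i < j → h < i' → i' < j' →
    ev3 I t (a h) (a i) (a j) ∈ D →
    ev3 I t (a h) (a i) (a j) = ev3 I t (a h) (a i') (a j')

variable {D : Set H} (hA : HomogeneousSeq L I a D)
include hA

namespace HomogeneousSeq

/-- One coincidence on an increasing triple is part of the type of triples, hence holds on all of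
them. -/
theorem left_of_eq {t : Code L K} {i j k : Ω} (hij : i < j) (hjk : j < k)
    (h : ev2 I t (a i) (a j) = ev2 I t (a i) (a k)) ⦃p q q' : Ω⦄ (hq : p < q) (hq' : p < q') :
    ev2 I t (a p) (a q) = ev2 I t (a p) (a q') := by
  have key : ∀ ⦃p q q' : Ω⦄, p < q → q < q' → ev2 I t (a p) (a q) = ev2 I t (a p) (a q') := by
    intro p q q' h1 h2
    have := hA.triple (sel2 t (0 : Fin 3) 1) (sel2 t (0 : Fin 3) 2) hij hjk h1 h2
    simp only [ev3_sel2] at this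
    exact this h
  rcases lt_trichotomy q q' with h | rfl | h
  · exact key hq h
  · rfl
  · exact (key hq' h).symm

theorem right_of_eq {t : Code L K} {i j k : Ω} (hij : i < j) (hjk : j < k)
    (h : ev2 I t (a i) (a k) = ev2 I t (a j) (a k)) ⦃p p' q : Ω⦄ (hp : p < q) (hp' : p' < q) :
    ev2 I t (a p) (a q) = ev2 I t (a p') (a q) := by
  have key : ∀ ⦃p p' q : Ω⦄, p < p' → p' < q → ev2 I t (a p) (a q) = ev2 I t (a p') (a q) := by
    intro p p' q h1 h2
    have := hA.triple (sel2 t (0 : Fin 3) 2) (sel2 t (1 : Fin 3) 2) hij hjk h1 h2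
    simp only [ev3_sel2] at this
    exact this h
  rcases lt_trichotomy p p' with h | rfl | h
  · exact key h hp'
  · rfl
  · exact (key h hp).symm

variable [NoMaxOrder Ω]

/-- Independence of the outer points allows both sides to be rewritten with outer points $\bot$ and
`n`. The coincidence is then a property of a quadruple starting at $\bot$, so it transfers to any
two middle points. -/
theorem constantOnTriples_of_eq {t : Code L K} (ht : DependsOnMiddle I a t) {g i m h j n : Ω}
    (hi : ⊥ < i) (hij : i < j) (hg : g < i) (hm : i < m) (hh : h < j) (hn : j < n)
    (heq : ev3 I t (a g) (a i) (a m) = ev3 I t (a h) (a j) (a n)) : ConstantOnTriples I a t := by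
  have h0 : ev3 I t (a ⊥) (a i) (a n) = ev3 I t (a ⊥) (a j) (a n) := by
    rw [ht hi (hij.trans hn) hg hm, heq, ht hh hn (hi.trans hij) hn]
  have key : ∀ ⦃p q r : Ω⦄, ⊥ < p → p < q → q < r →
      ev3 I t (a ⊥) (a p) (a r) = ev3 I t (a ⊥) (a q) (a r) := by
    intro p q r h1 h2 h3
    have := hA.quadruple_bot (sel3 t (0 : Fin 4) 1 3) (sel3 t (0 : Fin 4) 2 3) hi hij hn h1 h2 h3
    simp only [ev4_sel3] at this
    exact this h0
  intro h i j h' i' j' h1 h2 h3 h4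
  obtain ⟨r, hr'⟩ := exists_gt (max i i')
  obtain ⟨h5, h6⟩ := max_lt_iff.1 hr'
  have hi := bot_le.trans_lt h1
  have hi' := bot_le.trans_lt h3
  rw [ht h1 h2 hi h5, ht h3 h4 hi' h6]
  rcases lt_trichotomy i i' with h | rfl | h
  · exact key hi h h6
  · rfl
  · exact (key hi' h h5).symm

/-- The equation $t(i)=s(j)$ moves to all increasing pairs above $\bot$; comparing $t(p)=s(r)=t(q)$
shows that `t` is constant. -/
theorem hull1_inter_hull1 {i j : Ω} (hi : ⊥ < i) (hij : i < j) :
    hull1 L I a i ∩ hull1 L I a j ⊆ hull0 L I a := by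
  rintro x ⟨⟨t, ht, htx⟩, s, hs, hsx⟩
  obtain ⟨k, hjk⟩ := exists_gt j
  have key : ∀ ⦃p q r : Ω⦄, ⊥ < p → p < q → q < r →
      ev3 I t (a ⊥) (a p) (a r) = ev3 I s (a ⊥) (a q) (a r) := by
    intro p q r h1 h2 h3
    have := hA.quadruple_bot (sel3 t (0 : Fin 4) 1 3) (sel3 s (0 : Fin 4) 2 3) hi hij hjk h1 h2 h3
    simp only [ev4_sel3] at this
    exact this ((htx hi (hij.trans hjk)).trans (hsx (hi.trans hij) hjk).symm)
  obtain ⟨p, hp⟩ := exists_gt (⊥ : Ω)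
  obtain ⟨q, hq⟩ := exists_gt p
  obtain ⟨r, hr⟩ := exists_gt q
  obtain ⟨u, hu⟩ := exists_gt r
  rw [← htx hi (hij.trans hjk)]
  refine mem_hull0_of_constant (hA.constantOnTriples_of_eq ht hp hq hp
    (hq.trans (hr.trans hu)) (hp.trans hq) (hr.trans hu) ?_) hi (hij.trans hjk)
  exact (key hp (hq.trans hr) hu).trans (key (hp.trans hq) hr hu).symm

theorem hull1_inter_hull2 {m i j : Ω} (hm : ⊥ < m) (hi : ⊥ < i) (hij : i < j) (hmi : m ≠ i)
    (hmj : m ≠ j) : hull1 L I a m ∩ hull2 L I a i j ⊆ hull0 L I a := by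
  rintro x ⟨⟨t, ht, htx⟩, s, hsx⟩
  obtain ⟨n, hn⟩ := exists_gt m
  rw [← htx hm hn]
  suffices ConstantOnTriples I a t from mem_hull0_of_constant this hm hn
  obtain ⟨p, hp⟩ := exists_gt (⊥ : Ω)
  obtain ⟨q, hq⟩ := exists_gt p
  obtain ⟨r, hr⟩ := exists_gt q
  obtain ⟨u, hu⟩ := exists_gt r
  rcases hmi.lt_or_gt with h | h
  · have key : ∀ ⦃m i j : Ω⦄, ⊥ < m → m < i → i < j →
        ev3 I t (a ⊥) (a m) (a j) = ev2 I s (a i) (a j) := by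
      intro m' i' j' h1 h2 h3
      have := hA.quadruple_bot (sel3 t (0 : Fin 4) 1 3) (sel2 s (2 : Fin 4) 3) hm h hij h1 h2 h3
      simp only [ev4_sel3, ev4_sel2] at this
      exact this ((htx hm (h.trans hij)).trans hsx.symm)
    exact hA.constantOnTriples_of_eq ht hp hq hp (hq.trans (hr.trans hu)) (hp.trans hq)
      (hr.trans hu) ((key hp (hq.trans hr) hu).trans (key (hp.trans hq) hr hu).symm)
  rcases hmj.lt_or_gt with h' | h'
  · have key : ∀ ⦃i m j : Ω⦄, ⊥ < i → i < m → m < j →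
        ev3 I t (a ⊥) (a m) (a j) = ev2 I s (a i) (a j) := by
      intro i' m' j' h1 h2 h3
      have := hA.quadruple_bot (sel3 t (0 : Fin 4) 2 3) (sel2 s (1 : Fin 4) 3) hi h h' h1 h2 h3
      simp only [ev4_sel3, ev4_sel2] at this
      exact this ((htx hm h').trans hsx.symm)
    exact hA.constantOnTriples_of_eq ht (hp.trans hq) hr (hp.trans hq) (hr.trans hu)
      ((hp.trans hq).trans hr) hu
      ((key hp hq (hr.trans hu)).trans (key hp (hq.trans hr) hu).symm)
  -- With `m` above both points, `i` itself serves as the point below `m`. Adding $\bot$ would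
  -- require five points, whereas a quadruple with `i` and `j` fixed suffices.
  · have key : ∀ ⦃m n : Ω⦄, j < m → m < n →
        ev3 I t (a i) (a m) (a n) = ev2 I s (a i) (a j) := by
      intro m' n' h1 h2
      have := hA.quadruple (sel3 t (0 : Fin 4) 2 3) (sel2 s (0 : Fin 4) 1) hij h' hn h1 h2
      simp only [ev4_sel3, ev4_sel2] at this
      exact this ((htx h hn).trans hsx.symm)
    obtain ⟨n', hn'⟩ := exists_gt n
    exact hA.constantOnTriples_of_eq ht hm hn h hn (h.trans hn) hn'
      ((key h' hn).trans (key (h'.trans hn) hn').symm)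

/-- From $t(i,j)=s(i,k)$ on all triples, $t(i,j)=s(i,l)=t(i,k)$, so `t` does not see its upper
point. The other two ways of sharing one point are analogous. -/
theorem hull2_inter_left {i j k : Ω} (hij : i < j) (hjk : j < k) :
    hull2 L I a i j ∩ hull2 L I a i k ⊆ hull1 L I a i := by
  rintro x ⟨⟨t, rfl⟩, s, hs⟩
  have key : ∀ ⦃i j k : Ω⦄, i < j → j < k → ev2 I t (a i) (a j) = ev2 I s (a i) (a k) := by
    intro p q r h1 h2
    have := hA.triple (sel2 t (0 : Fin 3) 1) (sel2 s (0 : Fin 3) 2) hij hjk h1 h2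
    simp only [ev3_sel2] at this
    exact this hs.symm
  obtain ⟨l, hl⟩ := exists_gt k
  exact mem_hull1_of_left (hA.left_of_eq hij hjk
    ((key hij (hjk.trans hl)).trans (key (hij.trans hjk) hl).symm)) hij

theorem hull2_inter_right {i j k : Ω} (hij : i < j) (hjk : j < k) :
    hull2 L I a i k ∩ hull2 L I a j k ⊆ hull1 L I a k := by
  rintro x ⟨⟨t, rfl⟩, s, hs⟩
  have key : ∀ ⦃i j k : Ω⦄, i < j → j < k → ev2 I t (a i) (a k) = ev2 I s (a j) (a k) := by
    intro p q r h1 h2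
    have := hA.triple (sel2 t (0 : Fin 3) 2) (sel2 s (1 : Fin 3) 2) hij hjk h1 h2
    simp only [ev3_sel2] at this
    exact this hs.symm
  obtain ⟨l, hl⟩ := exists_gt k
  exact mem_hull1_of_right (hA.right_of_eq hij (hjk.trans hl)
    ((key (hij.trans hjk) hl).trans (key hjk hl).symm)) (hij.trans hjk)

theorem hull2_inter_middle {i j k : Ω} (hij : i < j) (hjk : j < k) :
    hull2 L I a i j ∩ hull2 L I a j k ⊆ hull1 L I a j := by
  rintro x ⟨⟨t, rfl⟩, s, hs⟩
  have key : ∀ ⦃i j k : Ω⦄, i < j → j < k → ev2 I t (a i) (a j) = ev2 I s (a j) (a k) := by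
    intro p q r h1 h2
    have := hA.triple (sel2 t (0 : Fin 3) 1) (sel2 s (1 : Fin 3) 2) hij hjk h1 h2
    simp only [ev3_sel2] at this
    exact this hs.symm
  obtain ⟨l, hl⟩ := exists_gt k
  exact mem_hull1_of_right (hA.right_of_eq hij hjk
    ((key (hij.trans hjk) hl).trans (key hjk hl).symm)) hij

/-- If the pairs are separated, the upper pair moves while the lower one is fixed, so `s` is
constant. If they interleave or are nested, moving the two upper points with `i` and `k` fixed frees
both codes from their upper arguments; $t(i,\cdot)=s(k,\cdot)$ then frees `t` from its lower
argument as well. -/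
theorem hull2_inter_disjoint {i j k l : Ω} (hij : i < j) (hkl : k < l) (hik : i < k)
    (hjk : j ≠ k) (hjl : j ≠ l) : hull2 L I a i j ∩ hull2 L I a k l ⊆ hull0 L I a := by
  rintro x ⟨⟨t, rfl⟩, s, hs⟩
  rcases hjk.lt_or_gt with h | h
  · have key : ∀ ⦃p q : Ω⦄, j < p → p < q → ev2 I t (a i) (a j) = ev2 I s (a p) (a q) := by
      intro p q h1 h2
      have := hA.quadruple (sel2 t (0 : Fin 4) 1) (sel2 s (2 : Fin 4) 3) hij h hkl h1 h2
      simp only [ev4_sel2] at this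
      exact this hs.symm
    obtain ⟨m, hm⟩ := exists_gt l
    rw [← hs]
    refine mem_hull0_of_left_right (hA.left_of_eq hkl hm ?_) (hA.right_of_eq hkl hm ?_) hkl
    · exact (key h hkl).symm.trans (key h (hkl.trans hm))
    · exact (key h (hkl.trans hm)).symm.trans (key (h.trans hkl) hm)
  obtain ⟨p, hp⟩ := exists_gt k
  obtain ⟨q, hq⟩ := exists_gt p
  obtain ⟨r, hr⟩ := exists_gt q
  have hleft : (∀ ⦃p q q' : Ω⦄, p < q → p < q' → ev2 I t (a p) (a q) = ev2 I t (a p) (a q')) ∧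
      (∀ ⦃p q q' : Ω⦄, p < q → p < q' → ev2 I s (a p) (a q) = ev2 I s (a p) (a q')) := by
    rcases hjl.lt_or_gt with h' | h'
    · have key : ∀ ⦃p q : Ω⦄, k < p → p < q → ev2 I t (a i) (a p) = ev2 I s (a k) (a q) := by
        intro p q h1 h2
        have := hA.quadruple (sel2 t (0 : Fin 4) 2) (sel2 s (1 : Fin 4) 3) hik h h' h1 h2
        simp only [ev4_sel2] at this
        exact this hs.symm
      exact ⟨hA.left_of_eq (hik.trans hp) hq
          ((key hp (hq.trans hr)).trans (key (hp.trans hq) hr).symm),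
        hA.left_of_eq (hp.trans hq) hr
          ((key hp hq).symm.trans (key hp (hq.trans hr)))⟩
    · have key : ∀ ⦃p q : Ω⦄, k < p → p < q → ev2 I t (a i) (a q) = ev2 I s (a k) (a p) := by
        intro p q h1 h2
        have := hA.quadruple (sel2 t (0 : Fin 4) 3) (sel2 s (1 : Fin 4) 2) hik hkl h' h1 h2
        simp only [ev4_sel2] at this
        exact this hs.symm
      exact ⟨hA.left_of_eq (hik.trans (hp.trans hq)) hr
          ((key hp hq).trans (key hp (hq.trans hr)).symm),
        hA.left_of_eq hp hq
          ((key hp (hq.trans hr)).symm.trans (key (hp.trans hq) hr))⟩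
  have key : ∀ ⦃p q r : Ω⦄, p < q → q < r → ev2 I t (a p) (a r) = ev2 I s (a q) (a r) := by
    intro p' q' r' h1 h2
    have := hA.triple (sel2 t (0 : Fin 3) 2) (sel2 s (1 : Fin 3) 2) hik hp h1 h2
    simp only [ev3_sel2] at this
    exact this ((hleft.1 (hik.trans hp) hij).trans (hs.symm.trans (hleft.2 hkl hp)))
  obtain ⟨u, hu⟩ := exists_gt r
  exact mem_hull0_of_left_right hleft.1 (hA.right_of_eq hq (hr.trans hu)
    ((key (hq.trans hr) hu).trans (key hr hu).symm)) hij

end HomogeneousSeq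

end Hulls

/-! ### Codes interpreted in $\mathscr H(\chi)$ -/

section HSetInterp

variable {χ lam : Cardinal.{u}}

theorem exists_surjective_ord_le (hlam : ℵ₀ ≤ lam) :
    ∃ g : lam.ord.ToType → Ordinal.{u}, Set.range g = Set.Iic lam.ord := by
  have h : #lam.ord.ToType = #(Order.succ lam.ord).ToType := by
    rw [Cardinal.mk_ord_toType, Cardinal.mk_toType, Order.succ_eq_add_one, Ordinal.card_add_one,
      Cardinal.card_ord, Cardinal.add_one_eq hlam]
  obtain ⟨e⟩ := Cardinal.eq.1 h
  refine ⟨fun k => (Ordinal.ToType.toOrd (e k) : Ordinal), ?_⟩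
  ext α
  constructor
  · rintro ⟨k, rfl⟩
    exact Set.mem_Iic.2 (Order.lt_succ_iff.1 (Set.mem_Iio.1 (Ordinal.ToType.toOrd (e k)).2))
  · intro hα
    refine ⟨e.symm (Ordinal.ToType.mk ⟨α, Set.mem_Iio.2 (Order.lt_succ_iff.2 (Set.mem_Iic.1 hα))⟩), ?_⟩
    simp

open Classical in
/-- The interpretation of codes in `H(χ)`: the constants are the ordinals `≤ λ`, and the operation
on short families is the formation of their range. -/
noncomputable def hsetInterp (hlam : ℵ₀ ≤ lam) (hχ : lam < χ) (r : HSet χ → HSet χ → Prop)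
    (wo : IsWellOrder (HSet χ) r) : Interp lam.ord.ToType (HSet χ) where
  r := r
  wo := wo
  const k := ⟨((exists_surjective_ord_le hlam).choose k).toZFSet,
    toZFSet_mem_HSet (hlam.trans hχ.le) (lt_of_le_of_lt
      ((exists_surjective_ord_le hlam).choose_spec ▸ Set.mem_range_self k :)
      (Cardinal.ord_lt_ord.2 hχ))⟩
  tt := ⟨Ordinal.toZFSet 1, toZFSet_mem_HSet (hlam.trans hχ.le)
    (Cardinal.lt_ord.2 (by simpa using Cardinal.one_lt_aleph0.trans_le (hlam.trans hχ.le)))⟩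
  ff := ⟨Ordinal.toZFSet 0, toZFSet_mem_HSet (hlam.trans hχ.le)
    (Cardinal.lt_ord.2 (by simpa using Cardinal.aleph0_pos.trans_le (hlam.trans hχ.le)))⟩
  tt_ne_ff h := one_ne_zero (Ordinal.toZFSet_injective (congrArg Subtype.val h))
  coll k f := if h : ZFSet.range (fun i => (f i : ZFSet.{u})) ∈ HSet χ then ⟨_, h⟩ else
    ⟨Ordinal.toZFSet 0, toZFSet_mem_HSet (hlam.trans hχ.le)
      (Cardinal.lt_ord.2 (by simpa using Cardinal.aleph0_pos.trans_le (hlam.trans hχ.le)))⟩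

theorem exists_Iio_equiv {Y : Type u} (hY : #Y < lam) :
    ∃ k : lam.ord.ToType, Nonempty (Set.Iio k ≃ Y) := by
  have h : (#Y).ord < Ordinal.type (fun a b : lam.ord.ToType => a < b) := by
    rw [Ordinal.type_toType]
    exact Cardinal.ord_lt_ord.2 hY
  refine ⟨Ordinal.enum (fun a b : lam.ord.ToType => a < b) ⟨_, h⟩, Cardinal.eq.1 ?_⟩
  have := Ordinal.card_typein (r := fun a b : lam.ord.ToType => a < b)
    (Ordinal.enum (fun a b : lam.ord.ToType => a < b) ⟨_, h⟩)
  rw [Ordinal.typein_enum, Cardinal.card_ord] at this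
  exact this.symm

variable {hlam : ℵ₀ ≤ lam} {hχ : lam < χ} {r : HSet χ → HSet χ → Prop}
  {wo : IsWellOrder (HSet χ) r} {S : Set (HSet χ)}

/-- A small subset is the range of a family indexed by a proper initial segment of $\lambda$. By the
cofinality bound this range lies in $\mathscr H(\chi)$, so the default value of `coll` does not
occur. -/
theorem subsetClosed_of_coll_mem (hcof : lam ≤ χ.ord.cof)
    (hS : ∀ k f, (∀ i, f i ∈ S) → (hsetInterp hlam hχ r wo).coll k f ∈ S) :
    SubsetClosed lam (toSets S) := by
  intro x hx hcard
  obtain ⟨k, ⟨e⟩⟩ := exists_Iio_equiv (Y := Shrink.{u} x) hcard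
  have hx' : ∀ y : x, ∃ z ∈ S, z.1 = y.1 := fun y => hx y.1 y.2
  choose g hgS hg using hx'
  let f : Set.Iio k → HSet χ := fun i => g ((equivShrink x).symm (e i))
  have hrange : ZFSet.range (fun i => (f i : ZFSet.{u})) = x := by
    ext y
    rw [ZFSet.mem_range]
    constructor
    · rintro ⟨i, rfl⟩
      rw [hg]
      exact Subtype.prop _
    · intro hy
      refine ⟨e.symm (equivShrink x ⟨y, hy⟩), ?_⟩
      simp [f, hg]
  have hmem : ZFSet.range (fun i => (f i : ZFSet.{u})) ∈ HSet χ :=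
    range_mem_HSet (hlam.trans hχ.le) (((Cardinal.mk_congr e).trans_lt hcard).trans_le hcof) _
      fun i => (f i).2
  refine ⟨_, hS k f fun i => hgS _, ?_⟩
  rw [← hrange]
  simp only [hsetInterp, dif_pos hmem]

theorem ordSets_subset_of_const_mem (hS : ∀ k, (hsetInterp hlam hχ r wo).const k ∈ S) :
    ordSets (Set.Iio (Order.succ lam.ord)) ⊆ toSets S := by
  rintro _ ⟨α, hα, rfl⟩
  have : α ∈ Set.Iic lam.ord := Set.mem_Iic.2 (Order.lt_succ_iff.1 (Set.mem_Iio.1 hα))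
  rw [← (exists_surjective_ord_le hlam).choose_spec] at this
  obtain ⟨k, rfl⟩ := this
  exact ⟨_, hS k, rfl⟩

theorem lift_le_mk_of_const_mem (hS : ∀ k, (hsetInterp hlam hχ r wo).const k ∈ S) :
    Cardinal.lift.{u + 1} lam ≤ #S := by
  have h1 : #(ordSets (Set.Iio (Order.succ lam.ord))) ≤ #S :=
    (Cardinal.mk_le_mk_of_subset (ordSets_subset_of_const_mem hS)).trans Cardinal.mk_image_le
  refine le_trans ?_ h1
  rw [ordSets, Cardinal.mk_image_eq Ordinal.toZFSet_injective, Cardinal.mk_Iio_ordinal,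
    Cardinal.lift_le]
  exact (Cardinal.card_ord lam).ge.trans (Ordinal.card_le_card (Order.le_succ _))

theorem mk_code_toType_le {L : FirstOrder.Language.{u, u}} (hlam : ℵ₀ ≤ lam)
    (hpow : lam ^< lam = lam) (hL : L.card ≤ lam) : #(Code L lam.ord.ToType) ≤ lam :=
  mk_code_le hlam hpow (Cardinal.mk_ord_toType lam).le (fun k =>
    (Cardinal.mk_Iio_lt k (by rw [Ordinal.type_toType, Cardinal.mk_ord_toType])).trans_eq
      (Cardinal.mk_ord_toType _)) hL

theorem mk_hull_eq {L : FirstOrder.Language.{u, u}} [L.Structure (HSet χ)]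
    (hpow : lam ^< lam = lam) (hL : L.card ≤ lam)
    (E : (ℕ → HSet χ) → (ℕ → HSet χ) → Prop) (v : ℕ → HSet χ) :
    #(hull L (hsetInterp hlam hχ r wo) E v) = Cardinal.lift.{u + 1} lam := by
  refine le_antisymm ?_ (lift_le_mk_of_const_mem fun k => const_mem_hull _ _ _ k)
  have h2 : hull L (hsetInterp hlam hχ r wo) E v ⊆
      Set.range fun t : Code L lam.ord.ToType => (hsetInterp hlam hχ r wo).eval t v := by
    rintro _ ⟨t, -, rfl⟩
    exact ⟨t, rfl⟩
  refine (Cardinal.mk_le_mk_of_subset h2).trans ?_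
  have h3 := Cardinal.mk_range_le_lift
    (f := fun t : Code L lam.ord.ToType => (hsetInterp hlam hχ r wo).eval t v)
  rw [Cardinal.lift_id'.{u, u + 1}] at h3
  exact h3.trans (Cardinal.lift_le.2 (mk_code_toType_le hlam hpow hL))

end HSetInterp

/-! ### The system of models and its coherence -/

section System

variable {L : FirstOrder.Language.{u, u}} {K : Type u} [LinearOrder K] {H : Type*}
  [L.Structure H] (I : Interp K H) {Ω : Type*} [LinearOrder Ω] [OrderBot Ω]
  (o : Ω → Ordinal.{u}) (a : Ω → H)

/-- The assignments attached to a set of at most two points. -/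
inductive Env : Finset Ordinal.{u} → (ℕ → H) → Prop
  | zero {h i j : Ω} (hi : h < i) (hj : i < j) : Env ∅ (pad I.ff ![a h, a i, a j])
  | one {h i j : Ω} (hi : h < i) (hj : i < j) : Env {o i} (pad I.ff ![a h, a i, a j])
  | two {i j : Ω} (hi : ⊥ < i) (hj : i < j) : Env {o i, o j} (pad I.ff ![a i, a j])

/-- The relation between assignments under which the codes used for sets of size `n` are
invariant. -/
def envRel : ℕ → (ℕ → H) → (ℕ → H) → Prop
  | 0 => fun v v' => ∃ h i j h' i' j', h < i ∧ i < j ∧ h' < i' ∧ i' < j' ∧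
      v = pad I.ff ![a h, a i, a j] ∧ v' = pad I.ff ![a h', a i', a j']
  | 1 => fun v v' => ∃ h i j h' j', h < i ∧ i < j ∧ h' < i ∧ i < j' ∧
      v = pad I.ff ![a h, a i, a j] ∧ v' = pad I.ff ![a h', a i, a j']
  | _ => fun _ _ => False

variable (L) in
/-- The model attached to a set of at most two points. -/
def modelSet (w : Finset Ordinal.{u}) : Set H :=
  {x | ∃ v, Env I o a w v ∧ x ∈ hull L I (envRel I a w.card) v}

variable {I o a}

omit [OrderBot Ω] in
theorem mem_invariantCodes_zero {t : Code L K} :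
    t ∈ invariantCodes L I (envRel I a 0) ↔ ConstantOnTriples I a t := by
  constructor
  · intro ht h i j h' i' j' h1 h2 h3 h4
    exact ht _ _ ⟨h, i, j, h', i', j', h1, h2, h3, h4, rfl, rfl⟩
  · rintro ht _ _ ⟨h, i, j, h', i', j', h1, h2, h3, h4, rfl, rfl⟩
    exact ht h1 h2 h3 h4

omit [OrderBot Ω] in
theorem mem_invariantCodes_one {t : Code L K} :
    t ∈ invariantCodes L I (envRel I a 1) ↔ DependsOnMiddle I a t := by
  constructor
  · intro ht h i j h' j' h1 h2 h3 h4
    exact ht _ _ ⟨h, i, j, h', j', h1, h2, h3, h4, rfl, rfl⟩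
  · rintro ht _ _ ⟨h, i, j, h', j', h1, h2, h3, h4, rfl, rfl⟩
    exact ht h1 h2 h3 h4

omit [OrderBot Ω] in
theorem hull_zero {h i j : Ω} (hi : h < i) (hj : i < j) :
    hull L I (envRel I a 0) (pad I.ff ![a h, a i, a j]) = hull0 L I a := by
  ext x
  constructor
  · rintro ⟨t, ht, rfl⟩
    rw [mem_invariantCodes_zero] at ht
    exact mem_hull0_of_constant ht hi hj
  · rintro ⟨t, ht, hx⟩
    exact ⟨t, mem_invariantCodes_zero.2 ht, hx hi hj⟩

omit [OrderBot Ω] in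
theorem hull_one {h i j : Ω} (hi : h < i) (hj : i < j) :
    hull L I (envRel I a 1) (pad I.ff ![a h, a i, a j]) = hull1 L I a i := by
  ext x
  constructor
  · rintro ⟨t, ht, rfl⟩
    rw [mem_invariantCodes_one] at ht
    exact ⟨t, ht, fun _ _ h3 h4 => ht h3 h4 hi hj⟩
  · rintro ⟨t, ht, hx⟩
    exact ⟨t, mem_invariantCodes_one.2 ht, hx hi hj⟩

omit [OrderBot Ω] in
theorem hull_two (i j : Ω) :
    hull L I (envRel I a 2) (pad I.ff ![a i, a j]) = hull2 L I a i j := by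
  ext x
  constructor
  · rintro ⟨t, -, rfl⟩
    exact ⟨t, rfl⟩
  · rintro ⟨t, hx⟩
    exact ⟨t, fun _ _ h => h.elim, hx⟩

section

variable (ho : StrictMono o)
include ho

omit [OrderBot Ω] in
theorem card_pair_of_lt {i j : Ω} (hij : i < j) : ({o i, o j} : Finset Ordinal.{u}).card = 2 :=
  Finset.card_pair (ho hij).ne

/-- Invariant codes have the same value at all assignments attached to `w`, so one of them suffices.
-/
theorem Env.modelSet_eq {w : Finset Ordinal.{u}} {v : ℕ → H} (hv : Env I o a w v) :
    modelSet L I o a w = hull L I (envRel I a w.card) v := by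
  refine subset_antisymm ?_ fun x hx => ⟨v, hv, hx⟩
  rintro x ⟨v', hv', hx⟩
  generalize hw : w = w' at hv'
  cases hv with
  | zero hi hj =>
    cases hv' with
    | zero hi' hj' =>
      simp only [Finset.card_empty] at hx ⊢
      rwa [hull_zero hi hj, ← hull_zero hi' hj']
    | one => exact absurd hw.symm (Finset.singleton_ne_empty _)
    | two => exact absurd hw.symm (Finset.insert_ne_empty _ _)
  | one hi hj =>
    cases hv' with
    | zero => simp at hw
    | one hi' hj' =>
      rw [Finset.singleton_inj] at hw
      obtain rfl := ho.injective hw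
      simp only [Finset.card_singleton] at hx ⊢
      rwa [hull_one hi hj, ← hull_one hi' hj']
    | two hi' hj' =>
      have := congrArg Finset.card hw
      simp [card_pair_of_lt ho hj'] at this
  | two hi hj =>
    cases hv' with
    | zero => simp at hw
    | one =>
      have := congrArg Finset.card hw
      simp [card_pair_of_lt ho hj] at this
    | @two p q hi' hj' =>
      have h1 := congrArg (fun s : Finset Ordinal.{u} => (↑s : Set Ordinal.{u})) hw
      simp only [Finset.coe_pair] at h1
      have h2 := ho hj
      have h3 := ho hj'
      rcases Set.pair_eq_pair_iff.1 h1 with ⟨h4, h5⟩ | ⟨h4, h5⟩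
      · rw [hw] at hx
        rwa [ho.injective h4, ho.injective h5]
      · rw [h4, h5] at h2
        exact absurd h2 h3.not_gt

variable [NoMaxOrder Ω]

omit ho in
theorem exists_env {U : Set Ordinal.{u}} (hU : U = o '' Set.Ioi ⊥) {w : Finset Ordinal.{u}}
    (hw : w ∈ AtMostTwo U) : ∃ v, Env I o a w v := by
  obtain ⟨h1, h2⟩ := hw
  subst hU
  have h3 : w.card = 0 ∨ w.card = 1 ∨ w.card = 2 := by omega
  rcases h3 with h | h | h
  · obtain rfl := Finset.card_eq_zero.1 h
    obtain ⟨i, hi⟩ := exists_gt (⊥ : Ω)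
    obtain ⟨j, hj⟩ := exists_gt i
    exact ⟨_, .zero hi hj⟩
  · obtain ⟨x, rfl⟩ := Finset.card_eq_one.1 h
    obtain ⟨i, hi, rfl⟩ := h1 (by simp : x ∈ (↑({x} : Finset Ordinal.{u}) : Set _))
    obtain ⟨j, hj⟩ := exists_gt i
    exact ⟨_, .one (Set.mem_Ioi.1 hi) hj⟩
  · obtain ⟨x, y, hxy, rfl⟩ := Finset.card_eq_two.1 h
    obtain ⟨i, hi, rfl⟩ := h1 (by simp : x ∈ (↑({x, y} : Finset Ordinal.{u}) : Set _))
    obtain ⟨j, hj, rfl⟩ := h1 (by simp : y ∈ (↑({o i, y} : Finset Ordinal.{u}) : Set _))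
    rcases lt_trichotomy i j with hij | rfl | hij
    · exact ⟨_, .two (Set.mem_Ioi.1 hi) hij⟩
    · exact absurd rfl hxy
    · rw [Finset.pair_comm]
      exact ⟨_, .two (Set.mem_Ioi.1 hj) hij⟩

omit ho in
theorem modelSet_empty : modelSet L I o a ∅ = hull0 L I a := by
  ext x
  constructor
  · rintro ⟨v, hv, hx⟩
    generalize hw : (∅ : Finset Ordinal.{u}) = w at hv
    cases hv with
    | zero hi hj => rwa [Finset.card_empty, hull_zero hi hj] at hx
    | one => exact absurd hw.symm (Finset.singleton_ne_empty _)
    | two => exact absurd hw.symm (Finset.insert_ne_empty _ _)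
  · intro hx
    obtain ⟨i, hi⟩ := exists_gt (⊥ : Ω)
    obtain ⟨j, hj⟩ := exists_gt i
    refine ⟨_, .zero hi hj, ?_⟩
    rwa [Finset.card_empty, hull_zero hi hj]

theorem modelSet_singleton {i : Ω} (hi : ⊥ < i) :
    modelSet L I o a {o i} = hull1 L I a i := by
  obtain ⟨j, hj⟩ := exists_gt i
  rw [(Env.one (I := I) (a := a) (o := o) hi hj).modelSet_eq ho, Finset.card_singleton,
    hull_one hi hj]

omit [NoMaxOrder Ω] in
theorem modelSet_pair {i j : Ω} (hi : ⊥ < i) (hij : i < j) :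
    modelSet L I o a {o i, o j} = hull2 L I a i j := by
  rw [(Env.two (I := I) (a := a) (o := o) hi hij).modelSet_eq ho, card_pair_of_lt ho hij, hull_two]

variable {D : Set H} (hA : HomogeneousSeq L I a D)
include hA

theorem modelSet_pair_inter_pair {i j k l : Ω} (hi : ⊥ < i) (hij : i < j) (hk : ⊥ < k)
    (hkl : k < l) (h : i < k ∨ i = k ∧ j < l) :
    modelSet L I o a {o i, o j} ∩ modelSet L I o a {o k, o l} ⊆
      modelSet L I o a ({o i, o j} ∩ {o k, o l}) := by
  rw [modelSet_pair ho hi hij, modelSet_pair ho hk hkl]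
  have inj := ho.injective
  rcases h with h | ⟨rfl, h⟩
  · by_cases hjl : j = l
    · subst hjl
      have : ({o i, o j} ∩ {o k, o j} : Finset Ordinal.{u}) = {o j} := by
        ext x
        have h1 := (ho h).ne
        have h2 := (ho hij).ne
        simp only [Finset.mem_inter, Finset.mem_insert, Finset.mem_singleton]
        constructor
        · rintro ⟨rfl | rfl, h3 | h3⟩
          · exact absurd h3 h1
          · exact h3
          · rfl
          · rfl
        · rintro rfl
          exact ⟨.inr rfl, .inr rfl⟩
      rw [this, modelSet_singleton ho (hi.trans hij)]
      exact hA.hull2_inter_right h hkl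
    by_cases hjk : j = k
    · subst hjk
      have : ({o i, o j} ∩ {o j, o l} : Finset Ordinal.{u}) = {o j} := by
        ext x
        have h1 := (ho hij).ne
        have h2 := (ho (hij.trans hkl)).ne
        simp only [Finset.mem_inter, Finset.mem_insert, Finset.mem_singleton]
        constructor
        · rintro ⟨rfl | rfl, h3 | h3⟩
          · exact absurd h3 h1
          · exact absurd h3 h2
          · rfl
          · rfl
        · rintro rfl
          exact ⟨.inr rfl, .inl rfl⟩
      rw [this, modelSet_singleton ho (hi.trans hij)]
      exact hA.hull2_inter_middle hij hkl
    · have : ({o i, o j} ∩ {o k, o l} : Finset Ordinal.{u}) = ∅ := by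
        ext x
        have h1 := (ho h).ne
        have h2 := (ho (h.trans hkl)).ne
        simp only [Finset.mem_inter, Finset.mem_insert, Finset.mem_singleton,
          Finset.notMem_empty, iff_false]
        rintro ⟨rfl | rfl, h3 | h3⟩
        · exact h1 h3
        · exact h2 h3
        · exact hjk (inj h3)
        · exact hjl (inj h3)
      rw [this, modelSet_empty]
      exact hA.hull2_inter_disjoint hij hkl h hjk hjl
  · have : ({o i, o j} ∩ {o i, o l} : Finset Ordinal.{u}) = {o i} := by
      ext x
      have h1 := (ho h).ne
      have h2 := (ho hij).ne'
      simp only [Finset.mem_inter, Finset.mem_insert, Finset.mem_singleton]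
      constructor
      · rintro ⟨rfl | rfl, h3 | h3⟩
        · rfl
        · rfl
        · exact h3
        · exact absurd h3 h1
      · rintro rfl
        exact ⟨.inl rfl, .inl rfl⟩
    rw [this, modelSet_singleton ho hi]
    exact hA.hull2_inter_left hij h

omit [NoMaxOrder Ω] hA ho in
theorem modelSet_inter_of_subset {w w' : Finset Ordinal.{u}} (h : w ⊆ w') :
    modelSet L I o a w ∩ modelSet L I o a w' ⊆ modelSet L I o a (w ∩ w') := by
  rw [Finset.inter_eq_left.2 h]
  exact Set.inter_subset_left

theorem modelSet_singleton_inter_pair {m i j : Ω} (hm : ⊥ < m) (hi : ⊥ < i) (hij : i < j) :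
    modelSet L I o a {o m} ∩ modelSet L I o a {o i, o j} ⊆
      modelSet L I o a ({o m} ∩ {o i, o j}) := by
  by_cases h : o m ∈ ({o i, o j} : Finset Ordinal.{u})
  · exact modelSet_inter_of_subset (Finset.singleton_subset_iff.2 h)
  rw [Finset.singleton_inter_of_notMem h, modelSet_singleton ho hm, modelSet_pair ho hi hij,
    modelSet_empty]
  refine hA.hull1_inter_hull2 hm hi hij ?_ ?_
  · rintro rfl
    simp at h
  · rintro rfl
    simp at h

theorem modelSet_inter {w w' : Finset Ordinal.{u}} {v v' : ℕ → H} (hv : Env I o a w v)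
    (hv' : Env I o a w' v') :
    modelSet L I o a w ∩ modelSet L I o a w' ⊆ modelSet L I o a (w ∩ w') := by
  cases hv with
  | zero => exact modelSet_inter_of_subset (Finset.empty_subset _)
  | @one _ i _ hi hj =>
    have hi := bot_le.trans_lt hi
    cases hv' with
    | zero =>
      rw [Set.inter_comm, Finset.inter_comm]
      exact modelSet_inter_of_subset (Finset.empty_subset _)
    | @one _ j _ hi' hj' =>
      have hi' := bot_le.trans_lt hi'
      by_cases h : i = j
      · subst h
        exact modelSet_inter_of_subset subset_rfl
      have : ({o i} ∩ {o j} : Finset Ordinal.{u}) = ∅ :=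
        Finset.singleton_inter_of_notMem (by simpa using fun h' => h (ho.injective h'))
      rw [this, modelSet_singleton ho hi, modelSet_singleton ho hi', modelSet_empty]
      rcases lt_or_gt_of_ne h with h | h
      · exact hA.hull1_inter_hull1 hi h
      · rw [Set.inter_comm]
        exact hA.hull1_inter_hull1 hi' h
    | two hi' hj' => exact modelSet_singleton_inter_pair ho hA hi hi' hj'
  | @two i j hi hj =>
    cases hv' with
    | zero =>
      rw [Set.inter_comm, Finset.inter_comm]
      exact modelSet_inter_of_subset (Finset.empty_subset _)
    | one hi' hj' =>
      rw [Set.inter_comm, Finset.inter_comm]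
      exact modelSet_singleton_inter_pair ho hA (bot_le.trans_lt hi') hi hj
    | @two k l hi' hj' =>
      rcases lt_trichotomy i k with h | rfl | h
      · exact modelSet_pair_inter_pair ho hA hi hj hi' hj' (.inl h)
      · rcases lt_trichotomy j l with h | rfl | h
        · exact modelSet_pair_inter_pair ho hA hi hj hi' hj' (.inr ⟨rfl, h⟩)
        · exact modelSet_inter_of_subset subset_rfl
        · rw [Set.inter_comm, Finset.inter_comm]
          exact modelSet_pair_inter_pair ho hA hi' hj' hi hj (.inr ⟨rfl, h⟩)
      · rw [Set.inter_comm, Finset.inter_comm]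
        exact modelSet_pair_inter_pair ho hA hi' hj' hi hj (.inl h)

omit ho in
-- A constant code with value `a m` equals the first-variable code on one triple, hence on all,
-- although the first variable also takes the value `a ⊥`.
theorem notMem_modelSet_empty {m : Ω} (hm : ⊥ < m) : a m ∉ modelSet L I o a ∅ := by
  rw [modelSet_empty]
  rintro ⟨t, -, ht⟩
  obtain ⟨p, hp⟩ := exists_gt m
  obtain ⟨q, hq⟩ := exists_gt p
  have h1 := hA.triple t (Code.var 0) hp hq (hm.trans hp) hq (ht hp hq)
  have h2 : a m = a ⊥ := (ht (hm.trans hp) hq).symm.trans h1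
  exact hm.ne' (hA.injective h2)

omit hA in
theorem self_mem_modelSet {m : Ω} (hm : ⊥ < m) : a m ∈ modelSet L I o a {o m} := by
  rw [modelSet_singleton ho hm]
  exact ⟨Code.var 1, fun _ _ _ _ _ _ _ _ _ => rfl, fun _ _ _ _ => rfl⟩

theorem mem_of_mem_modelSet {w : Finset Ordinal.{u}} {v : ℕ → H} (hv : Env I o a w v) {m : Ω}
    (hm : ⊥ < m) (h : a m ∈ modelSet L I o a w) : o m ∈ w := by
  by_contra hmw
  obtain ⟨j, hj⟩ := exists_gt m
  have := modelSet_inter ho hA (Env.one hm hj) hv ⟨self_mem_modelSet ho hm, h⟩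
  rw [Finset.singleton_inter_of_notMem hmw] at this
  exact notMem_modelSet_empty hA hm this

omit [NoMaxOrder Ω] in
theorem Env.sameType {w w' : Finset Ordinal.{u}} {v v' : ℕ → H} (hv : Env I o a w v)
    (hv' : Env I o a w' v') (h : w.card = w'.card) : SameType L I v v' := by
  have key : ∀ ⦃h i j h' i' j' : Ω⦄, h < i → i < j → h' < i' → i' < j' →
      SameType L I (pad I.ff ![a h, a i, a j]) (pad I.ff ![a h', a i', a j']) :=
    fun h i j h' i' j' h1 h2 h3 h4 s t =>
      ⟨hA.triple s t h1 h2 h3 h4, hA.triple s t h3 h4 h1 h2⟩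
  cases hv with
  | zero h1 h2 =>
    cases hv' with
    | zero h3 h4 => exact key h1 h2 h3 h4
    | one => simp at h
    | two h3 h4 => simp [card_pair_of_lt ho h4] at h
  | one h1 h2 =>
    cases hv' with
    | zero => simp at h
    | one h3 h4 => exact key h1 h2 h3 h4
    | two h3 h4 => simp [card_pair_of_lt ho h4] at h
  | @two i j h1 h2 =>
    cases hv' with
    | zero => simp [card_pair_of_lt ho h2] at h
    | one => simp [card_pair_of_lt ho h2] at h
    | @two i' j' h3 h4 =>
      intro s t
      have := key h1 h2 h3 h4 (sel2 s (1 : Fin 3) 2) (sel2 t (1 : Fin 3) 2)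
      simp only [eval_sel2] at this
      exact this

/-- The codes of the points. -/
def pointCodes : ℕ → Set (Code L K)
  | 0 => ∅
  | 1 => {Code.var 1}
  | _ => {Code.var 0, Code.var 1}

omit ho hA [NoMaxOrder Ω] [OrderBot Ω] in
theorem pointCodes_subset (n : ℕ) :
    (pointCodes n : Set (Code L K)) ⊆ invariantCodes L I (envRel I a n) := by
  match n with
  | 0 => exact Set.empty_subset _
  | 1 =>
    rintro _ rfl
    exact mem_invariantCodes_one.2 fun _ _ _ _ _ _ _ _ _ => rfl
  | _ + 2 => exact fun t _ _ _ h => h.elim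

omit [NoMaxOrder Ω] hA in
theorem Env.image_pointCodes {w : Finset Ordinal.{u}} {v : ℕ → H} (hv : Env I o a w v) :
    (fun t : Code L K => I.eval t v) '' pointCodes w.card = a '' (o ⁻¹' ↑w) := by
  have hinj : ∀ i, o ⁻¹' {o i} = {i} := fun i => by
    ext j
    simp [ho.injective.eq_iff]
  cases hv with
  | zero => simp [pointCodes]
  | one h1 h2 => simp [pointCodes, pad, hinj]
  | @two i j h1 h2 =>
    have hpre : o ⁻¹' {o i, o j} = {i, j} := by
      ext k
      simp [ho.injective.eq_iff]
    rw [card_pair_of_lt ho h2]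
    simp [pointCodes, pad, Set.image_pair, hpre]

/-- Evaluated on triples starting at $\bot$, a code with a value in `D` keeps that value when the
other two points move. -/
theorem modelSet_inter_value {w w' : Finset Ordinal.{u}} {v v' : ℕ → H} (hv : Env I o a w v)
    (hv' : Env I o a w' v') (h : w.card = w'.card) (hw : 1 ≤ w.card) :
    modelSet L I o a w ∩ D ⊆ modelSet L I o a w' := by
  rintro x ⟨hx, hxD⟩
  cases hv with
  | zero => simp at hw
  | one h1 h2 =>
    cases hv' with
    | zero => simp at h
    | one h3 h4 =>
      have h1' := bot_le.trans_lt h1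
      have h3' := bot_le.trans_lt h3
      rw [modelSet_singleton ho h1'] at hx
      rw [modelSet_singleton ho h3']
      obtain ⟨t, ht, htx⟩ := hx
      rw [← htx h1' h2] at hxD ⊢
      rw [hA.value t h1' h2 h3' h4 hxD]
      exact ⟨t, ht, fun _ _ h5 h6 => ht h5 h6 h3' h4⟩
    | two h3 h4 => simp [card_pair_of_lt ho h4] at h
  | two h1 h2 =>
    cases hv' with
    | zero => simp [card_pair_of_lt ho h2] at h
    | one => simp [card_pair_of_lt ho h2] at h
    | two h3 h4 =>
      rw [modelSet_pair ho h1 h2] at hx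
      rw [modelSet_pair ho h3 h4]
      obtain ⟨t, rfl⟩ := hx
      have := hA.value (sel2 t (1 : Fin 3) 2) h1 h2 h3 h4
      simp only [ev3_sel2] at this
      exact ⟨t, (this hxD).symm⟩

/-- Such a value also lies in the model of a disjoint set of the same size, and the two models meet
inside the model of the empty set. -/
theorem modelSet_inter_value_subset {w : Finset Ordinal.{u}} {v : ℕ → H} (hv : Env I o a w v)
    (hw : 1 ≤ w.card) : modelSet L I o a w ∩ D ⊆ modelSet L I o a ∅ := by
  intro x hx
  rw [modelSet_empty]
  cases hv with
  | zero => simp at hw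
  | @one _ i j h1 h2 =>
    have h1' := bot_le.trans_lt h1
    obtain ⟨k, hk⟩ := exists_gt j
    have := modelSet_inter_value ho hA (Env.one h1' h2) (Env.one (h1'.trans h2) hk) (by simp)
      (by simp) hx
    rw [modelSet_singleton ho (h1'.trans h2)] at this
    rw [modelSet_singleton ho h1'] at hx
    exact hA.hull1_inter_hull1 h1' h2 ⟨hx.1, this⟩
  | @two i j h1 h2 =>
    obtain ⟨k, hk⟩ := exists_gt j
    obtain ⟨l, hl⟩ := exists_gt k
    have hk' := h1.trans (h2.trans hk)
    have := modelSet_inter_value ho hA (Env.two h1 h2) (Env.two hk' hl)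
      (by rw [card_pair_of_lt ho h2, card_pair_of_lt ho hl]) hw hx
    rw [modelSet_pair ho hk' hl] at this
    rw [modelSet_pair ho h1 h2] at hx
    exact hA.hull2_inter_disjoint h2 hl (h2.trans hk) hk.ne (hk.trans hl).ne ⟨hx.1, this⟩

omit [NoMaxOrder Ω] in
/-- Values of codes at a point or a pair which agree with values at a subset are transferred along
the correspondence of the points. -/
theorem eval_eq_of_subset {w₁ v₁ w₂ v₂ : Finset Ordinal.{u}} {e₁ f₁ e₂ f₂ : ℕ → H}
    (he₁ : Env I o a w₁ e₁) (hf₁ : Env I o a v₁ f₁) (he₂ : Env I o a w₂ e₂)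
    (hf₂ : Env I o a v₂ f₂) (h₁ : w₁.card = v₁.card) (h₂ : w₂.card = v₂.card)
    (hlt : v₁.card < v₂.card) (f : H → Ordinal.{u}) (hf : ∀ i, f (a i) = o i)
    (himage : ∀ c ∈ (pointCodes v₂.card : Set (Code L K)), f (I.eval c f₂) ∈ v₁ →
      f (I.eval c e₂) ∈ w₁)
    (hsub : v₁ ⊆ v₂) {t s : Code L K} (ht : t ∈ invariantCodes L I (envRel I a v₁.card))
    (h : I.eval t f₁ = I.eval s f₂) : I.eval t e₁ = I.eval s e₂ := by
  cases hf₁ with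
  | @zero h i j h1 h2 =>
    rw [Finset.card_empty] at ht
    rw [mem_invariantCodes_zero] at ht
    rw [Finset.card_empty, Finset.card_eq_zero] at h₁
    subst h₁
    generalize hw₁ : (∅ : Finset Ordinal.{u}) = w₁ at he₁
    cases he₁ with
    | one => exact absurd hw₁.symm (Finset.singleton_ne_empty _)
    | two => exact absurd hw₁.symm (Finset.insert_ne_empty _ _)
    | zero h3 h4 =>
      cases hf₂ with
      | zero => simp at hlt
      | one h5 h6 =>
        cases he₂ with
        | zero => simp at h₂
        | two h7 h8 => simp [card_pair_of_lt ho h8] at h₂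
        | one h7 h8 =>
          exact (ht h3 h4 h7 h8).trans
            (hA.triple t s h5 h6 h7 h8 ((ht h5 h6 h1 h2).trans h))
      | two h5 h6 =>
        cases he₂ with
        | zero => simp [card_pair_of_lt ho h6] at h₂
        | one => simp [card_pair_of_lt ho h6] at h₂
        | two h7 h8 =>
          have := hA.triple t (sel2 s (1 : Fin 3) 2) h5 h6 h7 h8
          simp only [ev3_sel2] at this
          exact (ht h3 h4 h7 h8).trans (this ((ht h5 h6 h1 h2).trans h))
  | @one g i j h1 h2 =>
    rw [Finset.card_singleton] at ht
    rw [mem_invariantCodes_one] at ht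
    cases hf₂ with
    | zero => simp at hlt
    | one => simp at hlt
    | @two p q h5 h6 =>
      cases he₂ with
      | zero => simp [card_pair_of_lt ho h6] at h₂
      | one => simp [card_pair_of_lt ho h6] at h₂
      | @two p' q' h7 h8 =>
        cases he₁ with
        | zero => simp at h₁
        | two h3 h4 => simp [card_pair_of_lt ho h4] at h₁
        | @one g' i' j' h3 h4 =>
          rw [card_pair_of_lt ho h6] at himage
          have hi : o i = o p ∨ o i = o q := by simpa using hsub
          rcases hi with hi | hi
          · obtain rfl := ho.injective hi
            -- The image condition forces the singleton on the target side to be the corresponding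
            -- lower point. The triple with $\bot$ added below the pair then carries the equation.
            have : f (a p') ∈ ({o i'} : Finset Ordinal.{u}) :=
              himage (Code.var 0) (by simp [pointCodes]) (by simp [pad, hf])
            rw [hf, Finset.mem_singleton] at this
            obtain rfl := ho.injective this
            have h9 := hA.triple t (sel2 s (1 : Fin 3) 2) h5 h6 h7 h8
            simp only [ev3_sel2] at h9
            exact (ht h3 h4 h7 h8).trans (h9 ((ht h5 h6 h1 h2).trans h))
          · obtain rfl := ho.injective hi
            -- For the upper point, the pair is instead extended by a point above it, so that the
            -- shared point is again in the middle.
            have : f (a q') ∈ ({o i'} : Finset Ordinal.{u}) :=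
              himage (Code.var 1) (by simp [pointCodes]) (by simp [pad, hf])
            rw [hf, Finset.mem_singleton] at this
            obtain rfl := ho.injective this
            have h9 := hA.triple t (sel2 s (0 : Fin 3) 1) h6 h2 h8 h4
            simp only [ev3_sel2] at h9
            exact (ht h3 h4 h8 h4).trans (h9 ((ht h6 h2 h1 h2).trans h))
  | two h1 h2 =>
    rw [card_pair_of_lt ho h2] at hlt
    cases hf₂ with
    | zero => simp at hlt
    | one => simp at hlt
    | two h3 h4 => simp [card_pair_of_lt ho h4] at hlt

end

end System

/-! ### Construction of a solution for the partition relation -/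

section Solution

variable {lam κ θ χ : Cardinal.{u}}

open Classical in
theorem exists_homogeneousSeq (hlam : ℵ₀ ≤ lam) (hpow : lam ^< lam = lam) (hlamκ : lam ≤ κ)
    (hκ : κ ^ lam = κ) (hθ : (2 : Cardinal.{u}) ^ ((2 : Cardinal.{u}) ^ κ) < θ) (hχ : lam < χ)
    (hθχ : θ < χ) (r : HSet χ → HSet χ → Prop) (wo : IsWellOrder (HSet χ) r)
    (L : FirstOrder.Language.{u, u}) [L.Structure (HSet χ)] (hL : L.card ≤ lam) :
    ∃ o : WithBot (Order.succ κ).ord.ToType → Ordinal.{u}, StrictMono o ∧ (∀ w, o w < θ.ord) ∧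
      ∃ a : WithBot (Order.succ κ).ord.ToType → HSet χ, (∀ w, (a w).1 = (o w).toZFSet) ∧
        HomogeneousSeq L (hsetInterp hlam hχ r wo) a
          {x | x.1 ∈ ordSets (Set.Iio (Order.succ κ).ord)} := by
  set I := hsetInterp hlam hχ r wo with hI
  have hκ0 : ℵ₀ ≤ κ := hlam.trans hlamκ
  have hT : #(Code L lam.ord.ToType) ≤ lam := mk_code_toType_le hlam hpow hL
  let pt : θ.ord.ToType → HSet χ := fun x => ⟨(Ordinal.ToType.toOrd x : Ordinal).toZFSet,
    toZFSet_mem_HSet (hlam.trans hχ.le)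
      ((Set.mem_Iio.1 (Ordinal.ToType.toOrd x).2).trans (Cardinal.ord_lt_ord.2 hθχ))⟩
  let env : List θ.ord.ToType → ℕ → HSet χ := fun l => pad I.ff fun i : Fin l.length => pt (l.get i)
  have env3 : ∀ x y z, env [x, y, z] = pad I.ff ![pt x, pt y, pt z] := by
    intro x y z
    change pad I.ff _ = _
    congr 1
    funext i
    fin_cases i <;> rfl
  have env4 : ∀ x y z w, env [x, y, z, w] = pad I.ff ![pt x, pt y, pt z, pt w] := by
    intro x y z w
    change pad I.ff _ = _
    congr 1
    funext i
    fin_cases i <;> rfl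
  let tp : List θ.ord.ToType → Set (Code L lam.ord.ToType × Code L lam.ord.ToType) :=
    fun l => {q | I.eval q.1 (env l) = I.eval q.2 (env l)}
  let val : List θ.ord.ToType → Code L lam.ord.ToType → Option (Order.succ κ).ord.ToType :=
    fun l t => if h : ∃ d : (Order.succ κ).ord.ToType,
      (I.eval t (env l)).1 = (Ordinal.ToType.toOrd d : Ordinal).toZFSet then some h.choose else none
  have hval : ∀ l t d, val l t = some d →
      (I.eval t (env l)).1 = (Ordinal.ToType.toOrd d : Ordinal).toZFSet := by
    intro l t d h
    simp only [val] at h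
    split_ifs at h with h'
    rw [← Option.some.inj h]
    exact h'.choose_spec
  -- A type is a set of pairs of codes, so this bounds the number of types by $\kappa$.
  have h2lam : (2 : Cardinal.{u}) ^ lam ≤ κ := by
    calc (2 : Cardinal.{u}) ^ lam ≤ κ ^ lam :=
          Cardinal.power_le_power_right ((Cardinal.natCast_lt_aleph0 (n := 2)).le.trans hκ0)
      _ = κ := hκ
  have htp : #(Set (Code L lam.ord.ToType × Code L lam.ord.ToType)) ≤ κ := by
    rw [Cardinal.mk_set]
    refine le_trans (Cardinal.power_le_power_left two_ne_zero ?_) h2lam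
    rw [Cardinal.mk_prod, Cardinal.lift_id]
    exact Cardinal.mul_le_of_le hlam hT hT
  have h2κ : κ ≤ 2 ^ κ := (Cardinal.cantor κ).le
  -- The second colour records, for every code, its value if that is an ordinal below $\kappa^+$,
  -- and `none` otherwise.
  have hvalcard : #(Code L lam.ord.ToType → Option (Order.succ κ).ord.ToType) ≤ 2 ^ κ := by
    have h1 : #(Option (Order.succ κ).ord.ToType) ≤ 2 ^ κ := by
      rw [Cardinal.mk_option, Cardinal.mk_ord_toType]
      exact Cardinal.add_le_of_le (hκ0.trans h2κ) (Order.succ_le_of_lt (Cardinal.cantor κ))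
        (Cardinal.one_lt_aleph0.le.trans (hκ0.trans h2κ))
    calc #(Code L lam.ord.ToType → Option (Order.succ κ).ord.ToType)
        = #(Option (Order.succ κ).ord.ToType) ^ #(Code L lam.ord.ToType) := by simp
      _ ≤ (2 ^ κ) ^ #(Code L lam.ord.ToType) := Cardinal.power_le_power_right h1
      _ ≤ (2 ^ κ) ^ κ := Cardinal.power_le_power_left
          (Cardinal.aleph0_pos.trans_le (hκ0.trans h2κ)).ne' (hT.trans hlamκ)
      _ = 2 ^ κ := by rw [← Cardinal.power_mul, Cardinal.mul_eq_self hκ0]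
  obtain ⟨a, ha, h3, h4, h4b, hv⟩ := exists_homogeneous hκ0 (X := θ.ord.ToType)
    (by rwa [Cardinal.mk_ord_toType]) htp hvalcard tp val
  have toOrd_lt : StrictMono fun x : θ.ord.ToType => (Ordinal.ToType.toOrd x : Ordinal) :=
    fun x y h => Ordinal.ToType.mk.symm.strictMono h
  refine ⟨fun w => (Ordinal.ToType.toOrd (a w) : Ordinal), toOrd_lt.comp ha,
    fun w => Set.mem_Iio.1 (Ordinal.ToType.toOrd (a w)).2, fun w => pt (a w), fun w => rfl, ?_⟩
  constructor
  · intro w w' h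
    exact (toOrd_lt.comp ha).injective (Ordinal.toZFSet_injective (congrArg Subtype.val h))
  · intro s t h i j h' i' j' h1 h2 h3' h4' heq
    have := h3 _ _ _ _ _ _ h1 h2 h3' h4'
    have hmem : (s, t) ∈ tp [a h, a i, a j] := by
      change I.eval s (env _) = I.eval t (env _)
      rw [env3]
      exact heq
    rw [this] at hmem
    change I.eval s (env _) = I.eval t (env _) at hmem
    rw [env3] at hmem
    exact hmem
  · intro s t h i j k j' k' h1 h2 h3' h4' h5 heq
    have := h4 _ _ _ _ _ _ h1 h2 h3' h4' h5
    have hmem : (s, t) ∈ tp [a h, a i, a j, a k] := by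
      change I.eval s (env _) = I.eval t (env _)
      rw [env4]
      exact heq
    rw [this] at hmem
    change I.eval s (env _) = I.eval t (env _) at hmem
    rw [env4] at hmem
    exact hmem
  · intro s t i j k i' j' k' h1 h2 h3' h4' h5 h6 heq
    have := h4b _ _ _ _ _ _ h1 h2 h3' h4' h5 h6
    have hmem : (s, t) ∈ tp [a ⊥, a i, a j, a k] := by
      change I.eval s (env _) = I.eval t (env _)
      rw [env4]
      exact heq
    rw [this] at hmem
    change I.eval s (env _) = I.eval t (env _) at hmem
    rw [env4] at hmem
    exact hmem
  · intro t h i j i' j' h1 h2 h3' h4' hD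
    have heq := congrFun (hv _ _ _ _ _ h1 h2 h3' h4') t
    have hex : ∃ d : (Order.succ κ).ord.ToType, (I.eval t (env [a h, a i, a j])).1 =
        (Ordinal.ToType.toOrd d : Ordinal).toZFSet := by
      obtain ⟨α, hα, hαx⟩ := hD
      refine ⟨Ordinal.ToType.mk ⟨α, hα⟩, ?_⟩
      rw [env3]
      have h9 : (I.eval t (pad I.ff ![pt (a h), pt (a i), pt (a j)])).1 = α.toZFSet := hαx.symm
      simpa using h9
    have h5 : val [a h, a i, a j] t = some hex.choose := dif_pos hex
    have h6 := hval _ _ _ h5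
    have h7 := hval _ _ _ (heq.symm.trans h5)
    have h8 := Subtype.ext (h6.trans h7.symm)
    rw [env3, env3] at h8
    exact h8

theorem type_image_Ioi_bot {J : Type u} [LinearOrder J] [WellFoundedLT J]
    {o : WithBot J → Ordinal.{u}} (ho : StrictMono o) :
    Ordinal.type (fun a b : (o '' Set.Ioi ⊥ : Set Ordinal.{u}) => a < b) =
      Ordinal.lift.{u + 1} (Ordinal.type fun a b : J => a < b) := by
  let f : J → (o '' Set.Ioi ⊥ : Set Ordinal.{u}) := fun k =>
    ⟨o k, k, Set.mem_Ioi.2 (WithBot.bot_lt_coe k), rfl⟩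
  have hf : StrictMono f := fun x y h => ho (WithBot.coe_lt_coe.2 h)
  have hsurj : Function.Surjective f := by
    rintro ⟨_, w, hw, rfl⟩
    induction w using WithBot.recBotCoe with
    | bot => exact absurd (Set.mem_Ioi.1 hw) (lt_irrefl _)
    | coe k => exact ⟨k, rfl⟩
  have h := Ordinal.lift_type_eq.{u, u + 1, u + 1}.2
    ⟨(hf.orderIsoOfSurjective f hsurj).toRelIsoLT⟩
  rw [Ordinal.lift_id] at h
  exact h.symm

theorem nonempty_solution (hlam : ℵ₀ ≤ lam) (hpow : lam ^< lam = lam) (hlamκ : lam ≤ κ)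
    (hκ : κ ^ lam = κ) (hθ : (2 : Cardinal.{u}) ^ ((2 : Cardinal.{u}) ^ κ) < θ)
    (hlamθ : lam < θ) (hθχ : θ < χ) (hcof : lam ≤ χ.ord.cof) (r : HSet χ → HSet χ → Prop)
    (wo : IsWellOrder (HSet χ) r) (B : Expansion χ r) (hB : B.lang.card ≤ lam) :
    Nonempty (Solution θ (Order.succ κ) lam lam B) := by
  have hχ : lam < χ := hlamθ.trans hθχ
  have hκ0 : ℵ₀ ≤ κ := hlam.trans hlamκ
  obtain ⟨o, ho, hoθ, a, ha, hA⟩ := exists_homogeneousSeq hlam hpow hlamκ hκ hθ hχ hθχ r wo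
    B.lang hB
  set I := hsetInterp hlam hχ r wo with hI
  have := Cardinal.noMaxOrder (hκ0.trans (Order.le_succ κ))
  have : Nonempty (Order.succ κ).ord.ToType := Cardinal.mk_ne_zero_iff.1 (by
    rw [Cardinal.mk_ord_toType]
    exact (Cardinal.aleph0_pos.trans_le (hκ0.trans (Order.le_succ κ))).ne')
  have hrank : ∀ i, (a i).1.rank = o i := fun i => by rw [ha, Ordinal.rank_toZFSet]
  have mem_ordSets : ∀ (i) (w : Set Ordinal.{u}), (a i).1 ∈ ordSets w ↔ o i ∈ w := by
    intro i w
    rw [ha, ordSets, Ordinal.toZFSet_injective.mem_set_image]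
  have eq_point : ∀ (x : HSet χ) (i), x.1 = (o i).toZFSet → x = a i := fun x i h =>
    Subtype.ext (h.trans (ha i).symm)
  have hN : ∀ w : Finset Ordinal.{u}, ∃ N : B.lang.ElementarySubstructure (HSet χ),
      (∃ v, Env I o a w v) → (N : Set (HSet χ)) = modelSet B.lang I o a w := by
    intro w
    by_cases h : ∃ v, Env I o a w v
    · obtain ⟨v, hv⟩ := h
      obtain ⟨N, hN⟩ := ((representable_self (L := B.lang) I).skClosed_hull
        (envRel I a w.card) v).exists_elementarySubstructure
      exact ⟨N, fun _ => hN.trans (hv.modelSet_eq ho).symm⟩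
    · exact ⟨⊤, fun h' => absurd h' h⟩
  choose N hN using hN
  have he : ∀ w : Finset Ordinal.{u}, ∃ v, w ∈ AtMostTwo (o '' Set.Ioi ⊥) → Env I o a w v := by
    intro w
    by_cases h : w ∈ AtMostTwo (o '' Set.Ioi ⊥)
    · obtain ⟨v, hv⟩ := exists_env (I := I) (a := a) rfl h
      exact ⟨v, fun _ => hv⟩
    · exact ⟨fun _ => I.ff, fun h' => absurd h' h⟩
  choose e he using he
  have hNm : ∀ w ∈ AtMostTwo (o '' Set.Ioi ⊥),
      (N w : Set (HSet χ)) = modelSet B.lang I o a w := fun w hw => hN w ⟨e w, he w hw⟩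
  have hNe : ∀ w ∈ AtMostTwo (o '' Set.Ioi ⊥),
      (N w : Set (HSet χ)) = hull B.lang I (envRel I a w.card) (e w) := fun w hw =>
    (hNm w hw).trans ((he w hw).modelSet_eq ho)
  have hπ : ∀ w v : Finset Ordinal.{u}, w ∈ AtMostTwo (o '' Set.Ioi ⊥) →
      v ∈ AtMostTwo (o '' Set.Ioi ⊥) → w.card = v.card → ∃ p : N v ≃[B.lang] N w,
        ∀ t ∈ invariantCodes B.lang I (envRel I a v.card), ∀ ht : I.eval t (e v) ∈ N v,
          (p ⟨I.eval t (e v), ht⟩ : HSet χ) = I.eval t (e w) := fun w v hw hv h =>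
    exists_hullEquiv _ ((he v hv).sameType ho hA (he w hw) h.symm) (N v) (N w) (hNe v hv)
      (h ▸ hNe w hw)
  choose π hπ using hπ
  have hpts : ∀ w (hw : w ∈ AtMostTwo (o '' Set.Ioi ⊥)) (i), o i ∈ w →
      ∃ t ∈ (pointCodes w.card : Set (Code B.lang lam.ord.ToType)), I.eval t (e w) = a i := by
    intro w hw i hi
    have := (he w hw).image_pointCodes (L := B.lang) ho
    have hi' : a i ∈ a '' (o ⁻¹' ↑w) := Set.mem_image_of_mem a hi
    rw [← this] at hi'
    exact hi'
  have hpts' : ∀ w (hw : w ∈ AtMostTwo (o '' Set.Ioi ⊥)),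
      ∀ t ∈ (pointCodes w.card : Set (Code B.lang lam.ord.ToType)),
        ∃ i, o i ∈ w ∧ I.eval t (e w) = a i := by
    intro w hw t ht
    have := (he w hw).image_pointCodes (L := B.lang) ho
    obtain ⟨i, hi, hit⟩ := this ▸ Set.mem_image_of_mem (fun t => I.eval t (e w)) ht
    exact ⟨i, hi, hit.symm⟩
  have hptN : ∀ w (hw : w ∈ AtMostTwo (o '' Set.Ioi ⊥)),
      ∀ t ∈ (pointCodes w.card : Set (Code B.lang lam.ord.ToType)), I.eval t (e w) ∈ N w := by
    intro w hw t ht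
    rw [← SetLike.mem_coe, hNe w hw]
    exact ⟨t, pointCodes_subset _ ht, rfl⟩
  refine ⟨{
    U := o '' Set.Ioi ⊥
    N := N
    π := π
    U_lt := ?_
    otp_U := ?_
    closed := ?_
    inter_U := ?_
    card_N := ?_
    succ_subset := ?_
    inter_elem := ?_
    π_image := ?_
    π_compat := ?_
    inter_del_eq := ?_
    inter_del_subset := ?_ }⟩
  · rintro _ ⟨w, -, rfl⟩
    exact hoθ w
  · rw [type_image_Ioi_bot ho, Ordinal.type_toType]
  · intro w hw
    rw [hNe w hw]
    exact subsetClosed_of_coll_mem hcof fun k f hf => coll_mem_hull I _ _ k f hf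
  · intro w hw
    ext y
    constructor
    · rintro ⟨⟨x, hx, rfl⟩, _, ⟨m, hm, rfl⟩, hmx⟩
      obtain rfl := eq_point x m hmx.symm
      rw [hNm w hw] at hx
      exact (mem_ordSets m _).2 (mem_of_mem_modelSet ho hA (he w hw) (Set.mem_Ioi.1 hm) hx)
    · rintro ⟨α, hα, rfl⟩
      obtain ⟨m, hm, rfl⟩ := hw.1 hα
      obtain ⟨t, ht, htm⟩ := hpts w hw m hα
      exact ⟨⟨a m, htm ▸ hptN w hw t ht, ha m⟩, o m, ⟨m, hm, rfl⟩, rfl⟩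
  · intro w hw
    have h1 : #(N w) = #((N w : Set (HSet χ))) := rfl
    rw [h1, hNe w hw]
    exact mk_hull_eq hpow hB _ _
  · intro w hw
    rw [hNe w hw]
    exact ordSets_subset_of_const_mem fun k => const_mem_hull I _ _ k
  · intro w hw v hv
    have hwv : w ∩ v ∈ AtMostTwo (o '' Set.Ioi ⊥) :=
      ⟨fun x hx => hw.1 (Finset.mem_of_mem_inter_left hx),
        (Finset.card_le_card Finset.inter_subset_left).trans hw.2⟩
    have hsk : ∀ w ∈ AtMostTwo (o '' Set.Ioi ⊥), SkClosed I B.lang (N w : Set (HSet χ)) := by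
      intro w hw
      rw [hNe w hw]
      exact (representable_self (L := B.lang) I).skClosed_hull _ _
    -- Skolem functions choose the same least witness in both models, so only the inclusion remains.
    refine ((hsk w hw).inter (hsk v hv)).exists_elementarySubstructure_of_subset (N (w ∩ v)) ?_
    rw [hNm w hw, hNm v hv, hNm _ hwv]
    exact modelSet_inter ho hA (he w hw) (he v hv)
  · intro w v hw hv h
    ext y
    constructor
    · rintro ⟨x, ⟨α, hα, hαx⟩, rfl⟩
      obtain ⟨m, hm, rfl⟩ := hv.1 hα
      have hx := eq_point x.1 m hαx.symm
      obtain ⟨t, ht, htm⟩ := hpts v hv m hα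
      have hx' : x = ⟨I.eval t (e v), hptN v hv t ht⟩ := Subtype.ext (hx.trans htm.symm)
      rw [hx', hπ w v hw hv h t (pointCodes_subset _ ht)]
      obtain ⟨j, hj, hjt⟩ := hpts' w hw t (h ▸ ht)
      rw [hjt]
      exact (mem_ordSets j _).2 hj
    · rintro ⟨α, hα, rfl⟩
      obtain ⟨m, hm, rfl⟩ := hw.1 hα
      obtain ⟨t, ht, htm⟩ := hpts w hw m hα
      have ht' : t ∈ pointCodes v.card := h ▸ ht
      obtain ⟨j, hj, hjt⟩ := hpts' v hv t ht'
      refine ⟨⟨I.eval t (e v), hptN v hv t ht'⟩, ?_, ?_⟩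
      · change (I.eval t (e v)).1 ∈ _
        rw [hjt]
        exact (mem_ordSets j _).2 hj
      · rw [hπ w v hw hv h t (pointCodes_subset _ ht'), htm, ha]
  · intro w₁ v₁ w₂ v₂ hw₁ hv₁ hw₂ hv₂ h₁ h₂ hw hv himage x hx₁ hx₂
    -- When the sizes agree, both isomorphisms are literally the same map; otherwise the smaller set
    -- has a code with stronger invariance.
    rcases (Finset.card_le_card hv).eq_or_lt with hc | hc
    · obtain rfl := Finset.eq_of_subset_of_card_le hv hc.ge
      obtain rfl := Finset.eq_of_subset_of_card_le hw (by omega)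
      rfl
    have hx₁' : x ∈ hull B.lang I (envRel I a v₁.card) (e v₁) := hNe v₁ hv₁ ▸ hx₁
    have hx₂' : x ∈ hull B.lang I (envRel I a v₂.card) (e v₂) := hNe v₂ hv₂ ▸ hx₂
    obtain ⟨t, ht, rfl⟩ := hx₁'
    obtain ⟨s, hs, hst⟩ := hx₂'
    have hs' : I.eval s (e v₂) ∈ N v₂ := hst.symm ▸ hx₂
    have hsub : (⟨I.eval t (e v₁), hx₂⟩ : N v₂) = ⟨I.eval s (e v₂), hs'⟩ := Subtype.ext hst.symm
    rw [hπ w₁ v₁ hw₁ hv₁ h₁ t ht, hsub, hπ w₂ v₂ hw₂ hv₂ h₂ s hs]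
    refine eval_eq_of_subset ho hA (he w₁ hw₁) (he v₁ hv₁) (he w₂ hw₂) (he v₂ hv₂) h₁ h₂ hc
      -- The rank recovers the ordinal from the von Neumann ordinal representing it.
      (fun x => x.1.rank) hrank ?_ hv ht hst.symm
    intro c hcm hcv
    obtain ⟨i, hi, hic⟩ := hpts' v₂ hv₂ c hcm
    have hmem : (π w₂ v₂ hw₂ hv₂ h₂ ⟨I.eval c (e v₂), hptN v₂ hv₂ c hcm⟩).1.1 ∈
        ordSets (↑w₁ : Set Ordinal.{u}) := by
      rw [← himage]
      refine ⟨_, ?_, rfl⟩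
      change (I.eval c (e v₂)).1 ∈ _
      rw [hic, hrank] at hcv
      rw [hic]
      exact (mem_ordSets i _).2 hcv
    rw [hπ w₂ v₂ hw₂ hv₂ h₂ c (pointCodes_subset _ hcm)] at hmem
    obtain ⟨β, hβ, hβc⟩ := hmem
    rw [← hβc, Ordinal.rank_toZFSet]
    exact hβ
  · have key : ∀ w ∈ AtMostTwo (o '' Set.Ioi ⊥), ∀ v ∈ AtMostTwo (o '' Set.Ioi ⊥),
        w.card = v.card → 1 ≤ w.card →
        toSets (N w : Set (HSet χ)) ∩ ordSets (Set.Iio (Order.succ κ).ord) ⊆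
          toSets (N v : Set (HSet χ)) ∩ ordSets (Set.Iio (Order.succ κ).ord) := by
      rintro w hw v hv h hc _ ⟨⟨x, hx, rfl⟩, hxD⟩
      rw [hNm w hw] at hx
      refine ⟨⟨x, ?_, rfl⟩, hxD⟩
      rw [hNm v hv]
      exact modelSet_inter_value ho hA (he w hw) (he v hv) h hc ⟨hx, hxD⟩
    intro w hw v hv h hc
    exact (key w hw v hv h hc).antisymm (key v hv w hw h.symm (h ▸ hc))
  · rintro w hw hc _ ⟨⟨x, hx, rfl⟩, hxD⟩
    rw [hNm w hw] at hx
    refine ⟨x, ?_, rfl⟩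
    rw [hNm ∅ ⟨by simp, by simp⟩]
    exact modelSet_inter_value_subset ho hA (he w hw) hc ⟨hx, hxD⟩

end Solution

/-! ### An expansion with closed Skolem hulls -/

section GoodExpansion

/-- The symbols of `binaryLanguage`. -/
inductive BinarySymbol : ℕ → Type u
  | mem : BinarySymbol 2
  | lt : BinarySymbol 2

/-- The vocabulary with two binary relation symbols. -/
def binaryLanguage : FirstOrder.Language.{u, u} where
  Functions _ := PEmpty
  Relations := BinarySymbol

theorem card_binaryLanguage_le {lam : Cardinal.{u}} (hlam : ℵ₀ ≤ lam) :
    binaryLanguage.{u}.card ≤ lam := by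
  have h : Function.Injective fun x : binaryLanguage.{u}.Symbols =>
      (ULift.up (x.elim (fun _ => true) fun R => BinarySymbol.casesOn R.2 true false) :
        ULift.{u} Bool) := by
    rintro (⟨_, ⟨⟩⟩ | ⟨_, _ | _⟩) (⟨_, ⟨⟩⟩ | ⟨_, _ | _⟩) h
    · rfl
    · simp at h
    · simp at h
    · rfl
  refine (Cardinal.mk_le_of_injective h).trans (le_trans ?_ hlam)
  simp

variable {χ lam : Cardinal.{u}}

/-- Membership and a given relation on `H(χ)`. -/
@[reducible]
def binaryStructure (r : HSet χ → HSet χ → Prop) : binaryLanguage.{u}.Structure (HSet χ) where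
  funMap := fun f => PEmpty.elim f
  RelMap := fun R => match R with
    | .mem => fun a => (a 0).1 ∈ (a 1).1
    | .lt => fun a => r (a 0) (a 1)

/-- The language with a function symbol for every code. -/
def codeLanguage (lam : Cardinal.{u}) : FirstOrder.Language.{u, u} where
  Functions _ := Code binaryLanguage.{u} lam.ord.ToType
  Relations := binaryLanguage.{u}.Relations

theorem card_codeLanguage (hlam : ℵ₀ ≤ lam) (hpow : lam ^< lam = lam) :
    (codeLanguage lam).card = lam := by
  have hrel := card_binaryLanguage_le.{u} hlam
  apply le_antisymm
  · rw [FirstOrder.Language.card_eq_card_functions_add_card_relations] at hrel ⊢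
    refine Cardinal.add_le_of_le hlam ?_ ((self_le_add_left _ _).trans hrel)
    have h1 : #(Code binaryLanguage.{u} lam.ord.ToType) ≤ lam :=
      mk_code_toType_le hlam hpow (card_binaryLanguage_le hlam)
    change Cardinal.sum (fun _ : ℕ => Cardinal.lift.{u} #(Code binaryLanguage.{u} lam.ord.ToType)) ≤ lam
    rw [Cardinal.sum_const]
    simpa using Cardinal.mul_le_of_le hlam hlam h1
  · have h : Function.Injective fun k : lam.ord.ToType =>
        (Sum.inl ⟨0, Code.const k⟩ : (codeLanguage lam).Symbols) := by
      intro k k' hk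
      have h1 := eq_of_heq (Sigma.mk.inj (Sum.inl.inj hk)).2
      have h2 := (WType.mk.inj h1).1
      exact Shape.const.inj h2
    have := Cardinal.mk_le_of_injective h
    rwa [Cardinal.mk_ord_toType] at this

/-- The expansion of `H(χ)` by all functions with codes. -/
noncomputable def codeExpansion (hlam : ℵ₀ ≤ lam) (hχ : lam < χ) (r : HSet χ → HSet χ → Prop)
    (wo : IsWellOrder (HSet χ) r) : Expansion χ r where
  lang := codeLanguage lam
  str :=
    letI := binaryStructure r
    { funMap := fun t a => (hsetInterp hlam hχ r wo).eval
        (t : Code binaryLanguage.{u} lam.ord.ToType) (pad (hsetInterp hlam hχ r wo).ff a)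
      RelMap := fun R a => FirstOrder.Language.Structure.RelMap (L := binaryLanguage.{u}) R a }
  memSym := BinarySymbol.mem
  ltSym := BinarySymbol.lt
  memSym_iff _ _ := Iff.rfl
  ltSym_iff _ _ := Iff.rfl

/-- The new function symbols are codes, so composition represents the enlarged vocabulary by codes
and its Skolem functions create nothing new. Conversely, each code value is defined by an equation
with the corresponding symbol. The relation `False` imposes no invariance. -/
theorem skolemHull_codeExpansion (hlam : ℵ₀ ≤ lam) (hχ : lam < χ) (r : HSet χ → HSet χ → Prop)
    (wo : IsWellOrder (HSet χ) r) {n : ℕ} (a : Fin n → HSet χ) :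
    letI := binaryStructure r
    {x | SkolemHull (codeExpansion hlam hχ r wo) (Set.range a) x} =
      hull binaryLanguage.{u} (hsetInterp hlam hχ r wo) (fun _ _ => False)
        (pad (hsetInterp hlam hχ r wo).ff a) := by
  let := binaryStructure r
  have hrep : Representable binaryLanguage.{u} (hsetInterp hlam hχ r wo)
      (codeExpansion hlam hχ r wo).lang :=
    ⟨fun f s => ⟨Code.app f s, fun _ => rfl⟩, fun R s => ⟨Code.rel R s, fun _ => rfl⟩⟩
  ext x
  constructor
  · intro hx
    induction hx with
    | base x hx =>
      obtain ⟨i, rfl⟩ := hx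
      exact ⟨Code.var i, fun _ _ h => h.elim, pad_of_lt _ a i⟩
    | skolem n φ b hb y hy hmin ih =>
      have h := hrep.skClosed_hull (fun _ _ => False) (pad (hsetInterp hlam hχ r wo).ff a) n φ b ih
      rwa [(hsetInterp hlam hχ r wo).sk_eq hy hmin] at h
  · rintro ⟨t, -, rfl⟩
    let φ : (codeExpansion hlam hχ r wo).lang.Formula (Fin (n + 1)) :=
      FirstOrder.Language.Term.equal (FirstOrder.Language.Term.var 0)
        (FirstOrder.Language.Term.func
          (t : (codeExpansion hlam hχ r wo).lang.Functions n)
          fun i => FirstOrder.Language.Term.var i.succ)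
    have hφ : ∀ z, φ.Realize (Fin.cons z a : Fin (n + 1) → HSet χ) ↔
        z = (hsetInterp hlam hχ r wo).eval t (pad (hsetInterp hlam hχ r wo).ff a) := by
      intro z
      simp only [φ, FirstOrder.Language.Formula.realize_equal,
        FirstOrder.Language.Term.realize_var, Fin.cons_zero]
      rfl
    refine SkolemHull.skolem n φ a (fun i => SkolemHull.base _ (Set.mem_range_self i)) _ ((hφ _).2 rfl) fun z hz => ?_
    rw [(hφ z).1 hz]
    exact wo.wf.irrefl.irrefl _

theorem goodExpansion_codeExpansion (hlam : ℵ₀ ≤ lam) (hpow : lam ^< lam = lam) (hχ : lam < χ)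
    (hcof : lam ≤ χ.ord.cof) (r : HSet χ → HSet χ → Prop) (wo : IsWellOrder (HSet χ) r) :
    GoodExpansion lam (codeExpansion hlam hχ r wo) := by
  let := binaryStructure r
  refine ⟨card_codeLanguage hlam hpow, fun A hA => ?_⟩
  obtain ⟨n, a, rfl⟩ : ∃ (n : ℕ) (a : Fin n → HSet χ), Set.range a = A := by
    obtain ⟨n, a, -, ha⟩ := hA.fin_param
    exact ⟨n, a, ha⟩
  have h := skolemHull_codeExpansion hlam hχ r wo a
  constructor
  · change #↥{x | SkolemHull (codeExpansion hlam hχ r wo) (Set.range a) x} = _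
    rw [h]
    exact mk_hull_eq hpow (card_binaryLanguage_le hlam) _ _
  · rw [h]
    exact subsetClosed_of_coll_mem hcof fun k f hf => coll_mem_hull _ _ _ k f hf

end GoodExpansion

end SqPartition

theorem fact1p15 (lam κ del θ μ : Cardinal.{u}) (hlam : ℵ₀ ≤ lam)
    (hlam_pow : lam ^< lam = lam) (hlam_del : lam < del) (hdel_θ : del < θ) (hθ_μ : θ < μ)
    (hμ : μ ^ θ = μ) (hμ_small : ∀ α : Ordinal.{u}, α < μ.ord → α.card ^ lam < μ)
    (hθ : (2 : Cardinal.{u}) ^ ((2 : Cardinal.{u}) ^ κ) < θ) (hdel : del = Order.succ κ)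
    (hκ : κ ^ lam = κ) :
    SqPartition.ForcingHypothesis μ θ del lam := by
  subst hdel
  have hlamθ : lam < θ := hlam_del.trans hdel_θ
  exact
    { powerlt_eq := hlam_pow
      lam_lt := hlam_del
      del_lt := hdel_θ
      θ_lt := hθ_μ
      power_eq := hμ
      sq := ⟨hdel_θ, hlam_del.le, le_rfl, fun χ hθχ hcof r wo B hB =>
        SqPartition.nonempty_solution hlam hlam_pow (Order.lt_succ_iff.1 hlam_del) hκ hθ hlamθ hθχ
          hcof r wo B hB⟩
      exists_expansion := fun χ hθχ hcof r wo =>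
        ⟨SqPartition.codeExpansion hlam (hlamθ.trans hθχ) r wo,
          SqPartition.goodExpansion_codeExpansion hlam hlam_pow (hlamθ.trans hθχ) hcof r wo⟩ }
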